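/- Let $X$ be a real Hilbert space, $U=\mathbb R^m$, $Y=\mathbb R^p$, and let $(A,B,C,D)$ be a regular linear system: $A$ generates a $C_0$-semigroup $T$ on $X$, $B\in\mathcal L(U,X_{-1})$, $C\in\mathcal L(X_1,Y)$, $D\in\mathcal L(U,Y)$, where $X_1=(\mathcal D(A),\|(s_0-A)\cdot\|)$ and $X_{-1}$ is the completion of $(X,\|(s_0-A)^{-1}\cdot\|)$ for some $s_0\in\rho(A)$, and $G(s)=C_\Lambda(s-A_{-1})^{-1}B+D$ exists for real $s\in\rho(A)$, with $C_\Lambda x=\lim_{\lambda\to\infty}\lambda C(\lambda-A)^{-1}x$ (admissibility of $B$ and boundedness of the input-output map are not needed). Assume that $T$ is strongly stable, i.e. $T(t)x\to0$ for every $x\in X$, and that $C$ is infinite-time admissible, i.e. there is $K$ with $\int_0^\tau\|CT(t)x\|^2dt\le K\|x\|^2$ for all $\tau>0$, $x\in\mathcal D(A)$. Let $h>0$, $\delta=2/h\in\rho(A)$, and let $$A_d=-I+2\delta(\delta-A)^{-1},\quad B_d=\sqrt{2\delta}\,(\delta-A_{-1})^{-1}B,\quad C_d=\sqrt{2\delta}\,C(\delta-A)^{-1},\quad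 D_d=G(\delta)$$ be the Cayley–Tustin discretization, $x_j=A_dx_{j-1}+B_du_j$, $y_j=C_dx_{j-1}+D_du_j$. Let $Q\ge 0$ on $Y$ and $R>0$ on $U$ be self-adjoint, let $N\ge1$, and let $u_{\min},u_{\max},y_{\min},y_{\max}$ be componentwise bounds, possibly infinite. (0) There is exactly one positive (semidefinite) self-adjoint $\bar Q\in\mathcal L(X)$ with $A_d^*\bar QA_d-\bar Q=-C_d^*QC_d$. With this $\bar Q$ let $J(V,x)=V^THV+2V^TPx$ for $V\in U^N$, where $H=(h_{i,j})_{i,j=1}^N$ with $h_{i,i}=D_d^*QD_d+B_d^*\bar QB_d+R$, $h_{i,j}=D_d^*QC_dA_d^{i-j-1}B_d+B_d^*\bar QA_d^{i-j}B_d$ for $i>j$, $h_{i,j}=h_{j,i}^*$ for $i<j$, and $P=(D_d^*QC_dA_d^{i-1}+B_d^*\bar QA_d^i)_{i=1}^N$. Given a constraint set $F(x)\subset U^N$ for each $x\in X$, an MPC run from $x_0$ consists of states $(x_k)$ and $(U_k)$, $U_k=(u_{k+n|k})_{n=1}^N$, such that, for all $k\ge0$, $U_k$ minimizes $J(\cdot,x_k)$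 over $F(x_k)$ and $x_{k+1}=A_dx_k+B_du_{k+1}$ with $u_{k+1}:=u_{k+1|k}$. (1) Let $F(x)$ be the set of those $V\in U^N$ for which the input sequence $V$, continued by $u=0$ beyond the horizon, satisfies $u_{\min}\le u_j\le u_{\max}$ and $y_{\min}\le y_j\le y_{\max}$ for all $j\ge1$ along the trajectory that starts in $x$. If the problem is feasible at $x_0$, i.e. $F(x_0)\ne\emptyset$, then there is exactly one MPC run from $x_0$, and $U_k\to0$, hence $u_k\to0$, as $k\to\infty$. (2) Let instead $F(x)$ be given by the finitely many constraints $U_{\min}\le V\le U_{\max}$, $Y_{\min}\le SV+Tx\le Y_{\max}$, where $S=(s_{i,j})_{i,j=1}^N$ with $s_{i,i}=D_d$, $s_{i,j}=C_dA_d^{i-j-1}B_d$ for $i>j$, $s_{i,j}=0$ for $i<j$, and (in this formula only) $T=(C_dA_d^{i-1})_{i=1}^N$. For every MPC run such that, for each $k$, continuing $U_k$ by $u=0$ also satisfies the input and output bounds in the first step after the horizon, $U_k\to0$, hence $u_k\to0$. -/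

import Mathlib

open Filter Topology
open scoped NNReal

namespace RegMPC

noncomputable section

/-! ### `C₀`-semigroups, generators and resolvents -/

/-- A `C₀`-semigroup of bounded operators on a real Banach space. -/
structure C0Semigroup (X : Type*) [NormedAddCommGroup X] [NormedSpace ℝ X] where
  /-- the operators of the semigroup -/
  op : ℝ≥0 → X →L[ℝ] X
  op_zero : op 0 = 1
  op_add : ∀ s t, op (s + t) = op s * op t
  continuous_orbit : ∀ x, Continuous fun t => op t x

section Semigroup

variable {X : Type*} [NormedAddCommGroup X] [NormedSpace ℝ X]

/-- `T(t) x → 0` as `t → ∞`, for every `x`. -/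
def C0Semigroup.StronglyStable (T : C0Semigroup X) : Prop :=
  ∀ x, Tendsto (fun t => T.op t x) atTop (𝓝 0)

/-- `A` is the infinitesimal generator of `T`: `x ∈ D(A)` with `A x = y` iff the right derivative
of `t ↦ T(t) x` at `0` exists and equals `y`. -/
def IsGenerator (A : X →ₗ.[ℝ] X) (T : C0Semigroup X) : Prop :=
  ∀ x y : X, (x, y) ∈ A.graph ↔
    Tendsto (fun t : ℝ => t⁻¹ • (T.op t.toNNReal x - x)) (𝓝[>] 0) (𝓝 y)

theorem IsGenerator.op_mem {A : X →ₗ.[ℝ] X} {T : C0Semigroup X} (hA : IsGenerator A T)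
    (s : ℝ≥0) (x : A.domain) : T.op s x ∈ A.domain := by
  have h1 := (hA x (A x)).1 (A.mem_graph x)
  have h2 : ((T.op s x, T.op s (A x)) : X × X) ∈ A.graph := by
    rw [hA]
    have h3 := ((T.op s).continuous.tendsto _).comp h1
    refine h3.congr fun t => ?_
    have h4 : T.op s (T.op t.toNNReal x) = T.op t.toNNReal (T.op s x) := by
      have := congrArg (fun L : X →L[ℝ] X => L (x : X))
        ((T.op_add s t.toNNReal).symm.trans ((congrArg T.op (add_comm _ _)).trans
          (T.op_add t.toNNReal s)))
      simpa using this
    simp [map_sub, h4]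
  obtain ⟨y, hy, -⟩ := (LinearPMap.mem_graph_iff _).1 h2
  have hy' : (y : X) = T.op s x := hy
  exact hy' ▸ y.2

/-- `R` is a bounded two-sided inverse of `s - A : D(A) → X`. -/
structure IsResolventAt (A : X →ₗ.[ℝ] X) (s : ℝ) (R : X →L[ℝ] X) : Prop where
  mem : ∀ x, R x ∈ A.domain
  right_inv : ∀ x, s • R x - A ⟨R x, mem x⟩ = x
  left_inv : ∀ x : A.domain, R (s • (x : X) - A x) = x

/-- The (real) resolvent set `ρ(A)`. -/
def resSet (A : X →ₗ.[ℝ] X) : Set ℝ := {s | ∃ R : X →L[ℝ] X, IsResolventAt A s R}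

open Classical in
/-- The resolvent operator `(s - A)⁻¹` for `s ∈ ρ(A)` (and `0` otherwise). -/
def resOp (A : X →ₗ.[ℝ] X) (s : ℝ) : X →L[ℝ] X :=
  if h : s ∈ resSet A then h.choose else 0

theorem resOp_spec {A : X →ₗ.[ℝ] X} {s : ℝ} (h : s ∈ resSet A) :
    IsResolventAt A s (resOp A s) := by
  rw [resOp, dif_pos h]
  exact h.choose_spec

theorem resOp_mem (A : X →ₗ.[ℝ] X) (s : ℝ) (x : X) : resOp A s x ∈ A.domain := by
  by_cases h : s ∈ resSet A
  · exact (resOp_spec h).mem x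
  · rw [resOp, dif_neg h]
    exact A.domain.zero_mem

/-- The resolvent operator as a linear map into `D(A)`. -/
def resToDomain (A : X →ₗ.[ℝ] X) (s : ℝ) : X →ₗ[ℝ] A.domain :=
  (resOp A s : X →ₗ[ℝ] X).codRestrict A.domain (resOp_mem A s)

theorem resOp_injective {A : X →ₗ.[ℝ] X} {s : ℝ} (h : s ∈ resSet A) :
    Function.Injective (resOp A s) := by
  intro x y hxy
  have hs := resOp_spec h
  have h1 : (⟨resOp A s x, hs.mem x⟩ : A.domain) = ⟨resOp A s y, hs.mem y⟩ := Subtype.ext hxy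
  rw [← hs.right_inv x, ← hs.right_inv y, h1, hxy]

/-- `(s₀ - A) (s - A)⁻¹ x = x + (s₀ - s) (s - A)⁻¹ x`. -/
theorem shift_resToDomain {A : X →ₗ.[ℝ] X} {s : ℝ} (hs : s ∈ resSet A) (s₀ : ℝ) (x : X) :
    s₀ • (resToDomain A s x : X) - A (resToDomain A s x) = x + (s₀ - s) • resOp A s x := by
  have h := (resOp_spec hs).right_inv x
  have h' : A (resToDomain A s x) = s • resOp A s x - x := by
    rw [eq_sub_iff_add_eq, ← eq_sub_iff_add_eq']
    exact h.symm
  rw [h']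
  change s₀ • resOp A s x - _ = _
  rw [sub_smul]
  abel

/-- The resolvent identity. -/
theorem resOp_eq {A : X →ₗ.[ℝ] X} {s s₀ : ℝ} (hs : s ∈ resSet A) (hs₀ : s₀ ∈ resSet A) (x : X) :
    resOp A s x = resOp A s₀ x + (s₀ - s) • resOp A s (resOp A s₀ x) := by
  have h0 := shift_resToDomain hs₀ s x
  have h1 := (resOp_spec hs).left_inv (resToDomain A s₀ x)
  rw [h0, map_add, map_smul] at h1
  have h2 : resOp A s x + (s - s₀) • resOp A s (resOp A s₀ x) = resOp A s₀ x := h1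
  rw [eq_sub_of_add_eq h2, ← neg_sub s (s₀ : ℝ), neg_smul, sub_eq_add_neg]

/-! ### The extrapolation space `X₋₁` -/

/-- The vector space `X`, to be equipped with the norm `‖(s₀ - A)⁻¹ ·‖`. -/
@[nolint unusedArguments]
def PreExtrap (A : X →ₗ.[ℝ] X) (_s₀ : resSet A) : Type _ := X

instance (A : X →ₗ.[ℝ] X) (s₀ : resSet A) : AddCommGroup (PreExtrap A s₀) :=
  inferInstanceAs (AddCommGroup X)

instance (A : X →ₗ.[ℝ] X) (s₀ : resSet A) : Module ℝ (PreExtrap A s₀) :=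
  inferInstanceAs (Module ℝ X)

/-- `(s - A)⁻¹` as a linear map on `PreExtrap`. -/
def preRes (A : X →ₗ.[ℝ] X) (s₀ : resSet A) (s : ℝ) : PreExtrap A s₀ →ₗ[ℝ] X :=
  (resOp A s : X →ₗ[ℝ] X)

theorem preRes_injective (A : X →ₗ.[ℝ] X) (s₀ : resSet A) :
    Function.Injective (preRes A s₀ s₀) := by
  have h : Function.Injective (resOp A (s₀ : ℝ)) := resOp_injective s₀.2
  exact h

instance (A : X →ₗ.[ℝ] X) (s₀ : resSet A) : NormedAddCommGroup (PreExtrap A s₀) :=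
  NormedAddCommGroup.induced (PreExtrap A s₀) X (preRes A s₀ s₀)
    (preRes_injective A s₀)

instance (A : X →ₗ.[ℝ] X) (s₀ : resSet A) : NormedSpace ℝ (PreExtrap A s₀) :=
  NormedSpace.induced ℝ (PreExtrap A s₀) X (preRes A s₀ s₀)

/-- `X₋₁`: the completion of `X` with respect to the norm `‖(s₀ - A)⁻¹ ·‖`. -/
abbrev Extrap (A : X →ₗ.[ℝ] X) (s₀ : resSet A) : Type _ :=
  UniformSpace.Completion (PreExtrap A s₀)

theorem preRes_bound (A : X →ₗ.[ℝ] X) (s₀ : resSet A) (s : ℝ) :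
    ∃ K, ∀ x : PreExtrap A s₀, ‖preRes A s₀ s x‖ ≤ K * ‖x‖ := by
  by_cases hs : s ∈ resSet A
  · refine ⟨1 + ‖(s₀ : ℝ) - s‖ * ‖resOp A s‖, fun x => ?_⟩
    change ‖resOp A s x‖ ≤ _ * ‖resOp A s₀ x‖
    rw [resOp_eq hs s₀.2 x]
    calc _ ≤ ‖resOp A s₀ x‖ + ‖((s₀ : ℝ) - s) • resOp A s (resOp A s₀ x)‖ := norm_add_le _ _
      _ ≤ ‖resOp A s₀ x‖ + ‖(s₀ : ℝ) - s‖ * (‖resOp A s‖ * ‖resOp A s₀ x‖) := by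
        rw [norm_smul]
        gcongr
        exact (resOp A s).le_opNorm _
      _ = _ := by ring
  · refine ⟨0, fun x => ?_⟩
    change ‖resOp A s x‖ ≤ _
    rw [resOp, dif_neg hs, zero_mul]
    exact norm_zero.le

/-- `(s - A₋₁)⁻¹ : X₋₁ → X`, the continuous extension of `(s - A)⁻¹` to `X₋₁`. -/
def extrapRes [CompleteSpace X] (A : X →ₗ.[ℝ] X) (s₀ : resSet A) (s : ℝ) :
    Extrap A s₀ →L[ℝ] X :=
  ((preRes A s₀ s).mkContinuousOfExistsBound (preRes_bound A s₀ s)).extend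
    (UniformSpace.Completion.toComplL (𝕜 := ℝ) (E := PreExtrap A s₀))

/-- The `Λ`-extension `C_Λ x = lim_{λ → ∞} λ C (λ - A)⁻¹ x` of `C : D(A) → Y`, defined for those
`x ∈ X` for which the limit exists. -/
def lambdaExt {Y : Type*} [NormedAddCommGroup Y] [NormedSpace ℝ Y] (A : X →ₗ.[ℝ] X)
    (C : A.domain →ₗ[ℝ] Y) : X →ₗ.[ℝ] Y where
  domain :=
    { carrier := {x | ∃ y, Tendsto (fun l : ℝ => l • C (resToDomain A l x)) atTop (𝓝 y)}
      add_mem' := by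
        rintro a b ⟨y, hy⟩ ⟨z, hz⟩
        exact ⟨y + z, (hy.add hz).congr fun l => by simp⟩
      zero_mem' := ⟨0, by simp⟩
      smul_mem' := by
        rintro c a ⟨y, hy⟩
        exact ⟨c • y, (hy.const_smul c).congr fun l => by simp [smul_comm c l]⟩ }
  toFun :=
    { toFun := fun x => x.2.choose
      map_add' := fun a b => tendsto_nhds_unique (a + b).2.choose_spec
        ((a.2.choose_spec.add b.2.choose_spec).congr fun l => by simp)
      map_smul' := fun c a => tendsto_nhds_unique (c • a).2.choose_spec
        ((a.2.choose_spec.const_smul c).congr fun l => by simp [smul_comm c l]) }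

end Semigroup

/-! ### Regular linear systems and their Cayley–Tustin discretization -/

/-- The input space `ℝᵐ` or output space `ℝᵖ`. -/
abbrev Vec (n : ℕ) : Type := EuclideanSpace ℝ (Fin n)

/-- A regular linear system `(A, B, C, D)` on a real Hilbert space `X` with input space `ℝᵐ` and
output space `ℝᵖ`. Only regularity is required, in the form that
`C_Λ (s - A₋₁)⁻¹ B` exists; admissibility of `B` and boundedness of the input-output map, which
belong to well-posedness, are not required. Then `G(s) = C_Λ (s - A₋₁)⁻¹ B + D` converges strongly
to `D` as `s → ∞` by the resolvent identity. -/
structure RegularSystem (X : Type*) [NormedAddCommGroup X] [InnerProductSpace ℝ X]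
    [CompleteSpace X] (m p : ℕ) where
  /-- the semigroup -/
  T : C0Semigroup X
  /-- the generator -/
  A : X →ₗ.[ℝ] X
  isGenerator : IsGenerator A T
  /-- the point of `ρ(A)` used in the norms of `X₁` and `X₋₁` -/
  s₀ : resSet A
  /-- the control operator -/
  B : Vec m →L[ℝ] Extrap A s₀
  /-- the observation operator -/
  C : A.domain →ₗ[ℝ] Vec p
  /-- `C` is bounded for the norm `‖(s₀ - A) ·‖` of `X₁` -/
  C_bounded : ∃ K, ∀ x : A.domain, ‖C x‖ ≤ K * ‖(s₀ : ℝ) • (x : X) - A x‖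
  /-- the feedthrough operator -/
  D : Vec m →L[ℝ] Vec p
  regular : ∀ s ∈ resSet A, ∀ u, extrapRes A s₀ s (B u) ∈ (lambdaExt A C).domain

/-- A discrete-time system `x(k) = A_d x(k-1) + B_d u(k)`, `y(k) = C_d x(k-1) + D_d u(k)` with
bounded operators. -/
structure DiscreteSystem (X : Type*) [NormedAddCommGroup X] [InnerProductSpace ℝ X]
    (m p : ℕ) where
  /-- state operator -/
  Ad : X →L[ℝ] X
  /-- input operator -/
  Bd : Vec m →L[ℝ] X
  /-- output operator -/
  Cd : X →L[ℝ] Vec p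
  /-- feedthrough operator -/
  Dd : Vec m →L[ℝ] Vec p

namespace RegularSystem

variable {X : Type*} [NormedAddCommGroup X] [InnerProductSpace ℝ X] [CompleteSpace X] {m p : ℕ}

/-- Infinite-time admissibility of `C`: there is `K` with
`∫₀^τ ‖C T(t) x‖² dt ≤ K ‖x‖²` for all `τ > 0` and all `x ∈ D(A)`. -/
def InfiniteTimeAdmissible (S : RegularSystem X m p) : Prop :=
  ∃ K : ℝ, ∀ τ : ℝ, 0 < τ → ∀ x : S.A.domain,
    ∫ t in (0 : ℝ)..τ, ‖S.C ⟨S.T.op t.toNNReal x, S.isGenerator.op_mem t.toNNReal x⟩‖ ^ 2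
      ≤ K * ‖(x : X)‖ ^ 2

/-- The transfer function `G(s) = C_Λ (s - A₋₁)⁻¹ B + D`, `s ∈ ρ(A)`. -/
def transferFunction (S : RegularSystem X m p) (s : ℝ) (hs : s ∈ resSet S.A) :
    Vec m →L[ℝ] Vec p :=
  LinearMap.toContinuousLinearMap
    ((lambdaExt S.A S.C).toFun ∘ₗ
      ((extrapRes S.A S.s₀ s ∘L S.B : Vec m →L[ℝ] X) : Vec m →ₗ[ℝ] X).codRestrict
        (lambdaExt S.A S.C).domain (S.regular s hs)) + S.D

theorem C_res_bound (S : RegularSystem X m p) (s : ℝ) :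
    ∃ K, ∀ x : X, ‖(S.C ∘ₗ resToDomain S.A s) x‖ ≤ K * ‖x‖ := by
  by_cases hs : s ∈ resSet S.A
  · obtain ⟨K, hK⟩ := S.C_bounded
    refine ⟨|K| * (1 + ‖(S.s₀ : ℝ) - s‖ * ‖resOp S.A s‖), fun x => ?_⟩
    have h1 := hK (resToDomain S.A s x)
    rw [shift_resToDomain hs] at h1
    calc _ ≤ K * ‖x + ((S.s₀ : ℝ) - s) • resOp S.A s x‖ := h1
      _ ≤ |K| * (‖x‖ + ‖(S.s₀ : ℝ) - s‖ * (‖resOp S.A s‖ * ‖x‖)) := by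
        refine mul_le_mul (le_abs_self K) ((norm_add_le _ _).trans ?_) (norm_nonneg _)
          (abs_nonneg K)
        rw [norm_smul]
        gcongr
        exact (resOp S.A s).le_opNorm _
      _ = _ := by ring
  · refine ⟨0, fun x => ?_⟩
    have h0 : resToDomain S.A s x = 0 := by
      apply Subtype.ext
      change resOp S.A s x = 0
      rw [resOp, dif_neg hs]
      rfl
    simp [h0]

/-- The Cayley–Tustin discretization with parameter `δ`. -/
def cayleyTustin (S : RegularSystem X m p) (δ : ℝ) (hδ : δ ∈ resSet S.A) :
    DiscreteSystem X m p where
  Ad := -1 + (2 * δ) • resOp S.A δ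
  Bd := √(2 * δ) • (extrapRes S.A S.s₀ δ ∘L S.B)
  Cd := √(2 * δ) • (S.C ∘ₗ resToDomain S.A δ).mkContinuousOfExistsBound (S.C_res_bound δ)
  Dd := S.transferFunction δ hδ

end RegularSystem

/-! ### The constrained quadratic MPC problem -/

/-- Lower and upper bounds for the components of inputs and outputs; infinite bounds mean that a
component is unconstrained. -/
structure Bounds (m p : ℕ) where
  /-- lower input bounds -/
  uMin : Fin m → EReal
  /-- upper input bounds -/
  uMax : Fin m → EReal
  /-- lower output bounds -/
  yMin : Fin p → EReal
  /-- upper output bounds -/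
  yMax : Fin p → EReal

/-- `u_min ≤ u ≤ u_max` -/
def Bounds.InputOK {m p : ℕ} (b : Bounds m p) (u : Vec m) : Prop :=
  ∀ i, b.uMin i ≤ (u i : EReal) ∧ (u i : EReal) ≤ b.uMax i

/-- `y_min ≤ y ≤ y_max` -/
def Bounds.OutputOK {m p : ℕ} (b : Bounds m p) (y : Vec p) : Prop :=
  ∀ i, b.yMin i ≤ (y i : EReal) ∧ (y i : EReal) ≤ b.yMax i

namespace DiscreteSystem

variable {X : Type*} [NormedAddCommGroup X] [InnerProductSpace ℝ X] [CompleteSpace X] {m p : ℕ}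

open ContinuousLinearMap (adjoint)

/-- `Qb` is a positive self-adjoint solution of the discrete-time Lyapunov equation
`A_d^* Qb A_d - Qb = -C_d^* Q C_d`. -/
def IsLyapunovSolution (d : DiscreteSystem X m p) (Q : Vec p →L[ℝ] Vec p)
    (Qb : X →L[ℝ] X) : Prop :=
  Qb.IsPositive ∧ adjoint d.Ad ∘L Qb ∘L d.Ad - Qb = -(adjoint d.Cd ∘L Q ∘L d.Cd)

/-- The blocks of `H` on and below the diagonal, as a function of `n = i - j ≥ 0`. -/
def blockH (d : DiscreteSystem X m p) (Q : Vec p →L[ℝ] Vec p) (R : Vec m →L[ℝ] Vec m)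
    (Qb : X →L[ℝ] X) : ℕ → (Vec m →L[ℝ] Vec m)
  | 0 => adjoint d.Dd ∘L Q ∘L d.Dd + adjoint d.Bd ∘L Qb ∘L d.Bd + R
  | n + 1 => adjoint d.Dd ∘L Q ∘L d.Cd ∘L (d.Ad ^ n) ∘L d.Bd
      + adjoint d.Bd ∘L Qb ∘L (d.Ad ^ (n + 1)) ∘L d.Bd

/-- The block `h i j` of `H ∈ L(Uᴺ)`. -/
def matH (d : DiscreteSystem X m p) (Q : Vec p →L[ℝ] Vec p) (R : Vec m →L[ℝ] Vec m)
    (Qb : X →L[ℝ] X) {N : ℕ} (i j : Fin N) : Vec m →L[ℝ] Vec m :=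
  if j ≤ i then d.blockH Q R Qb ((i : ℕ) - j) else adjoint (d.blockH Q R Qb ((j : ℕ) - i))

/-- The components of `P ∈ L(X, Uᴺ)`; the index `i` starts from `0`. -/
def matP (d : DiscreteSystem X m p) (Q : Vec p →L[ℝ] Vec p) (Qb : X →L[ℝ] X) {N : ℕ}
    (i : Fin N) : X →L[ℝ] Vec m :=
  adjoint d.Dd ∘L Q ∘L d.Cd ∘L (d.Ad ^ (i : ℕ)) + adjoint d.Bd ∘L Qb ∘L (d.Ad ^ ((i : ℕ) + 1))

/-- The cost `J(U, x) = Uᵀ H U + 2 Uᵀ P x`. -/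
def cost (d : DiscreteSystem X m p) (Q : Vec p →L[ℝ] Vec p) (R : Vec m →L[ℝ] Vec m)
    (Qb : X →L[ℝ] X) {N : ℕ} (x : X) (U : Fin N → Vec m) : ℝ :=
  (∑ i, ∑ j, inner ℝ (U i) (d.matH Q R Qb i j (U j))) + 2 * ∑ i, inner ℝ (U i) (d.matP Q Qb i x)

/-- The block `s i j` of `S ∈ L(Uᴺ, Yᴺ)`. -/
def matS (d : DiscreteSystem X m p) {N : ℕ} (i j : Fin N) : Vec m →L[ℝ] Vec p :=
  if i = j then d.Dd
  else if j < i then d.Cd ∘L (d.Ad ^ ((i : ℕ) - (j : ℕ) - 1)) ∘L d.Bd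
  else 0

/-- The components of `T ∈ L(X, Yᴺ)`; the index `i` starts from `0`. -/
def matT (d : DiscreteSystem X m p) {N : ℕ} (i : Fin N) : X →L[ℝ] Vec p :=
  d.Cd ∘L (d.Ad ^ (i : ℕ))

/-- The finite-horizon constraints `U_min ≤ U ≤ U_max`, `Y_min ≤ S U + T x ≤ Y_max`. -/
def horizonFeasible (d : DiscreteSystem X m p) (b : Bounds m p) (N : ℕ) (x : X) :
    Set (Fin N → Vec m) :=
  {U | ∀ i, b.InputOK (U i) ∧ b.OutputOK ((∑ j, d.matS i j (U j)) + d.matT i x)}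

/-- The state reached from `x` after `n` steps with inputs `u 0, u 1, …`. -/
def state (d : DiscreteSystem X m p) (x : X) (u : ℕ → Vec m) : ℕ → X
  | 0 => x
  | n + 1 => d.Ad (d.state x u n) + d.Bd (u n)

/-- Continuation of `U` by zero inputs beyond the horizon. -/
def zeroExt {N : ℕ} (U : Fin N → Vec m) (n : ℕ) : Vec m :=
  if h : n < N then U ⟨n, h⟩ else 0

/-- The input and output bounds hold in step `n` (starting from `0`) of the trajectory from `x`
under `U` continued by zero. -/
def BoundsHoldAt (d : DiscreteSystem X m p) (b : Bounds m p) {N : ℕ} (x : X)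
    (U : Fin N → Vec m) (n : ℕ) : Prop :=
  b.InputOK (zeroExt U n) ∧
    b.OutputOK (d.Cd (d.state x (zeroExt U) n) + d.Dd (zeroExt U n))

/-- The constraints of the infinite-horizon problem for inputs that vanish beyond the horizon:
the input and output bounds hold in all steps. -/
def allTimeFeasible (d : DiscreteSystem X m p) (b : Bounds m p) (N : ℕ) (x : X) :
    Set (Fin N → Vec m) :=
  {U | ∀ n, d.BoundsHoldAt b x U n}

/-- The closed loop: at each time `k` the input sequence `U k` minimizes `J(·, x k)` over the
constraint set `F (x k)`, and its first element is applied to the system. -/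
structure IsClosedLoop (d : DiscreteSystem X m p) (Q : Vec p →L[ℝ] Vec p)
    (R : Vec m →L[ℝ] Vec m) (Qb : X →L[ℝ] X) {N : ℕ} (hN : 0 < N)
    (F : X → Set (Fin N → Vec m)) (x₀ : X) (x : ℕ → X) (U : ℕ → Fin N → Vec m) : Prop where
  initial : x 0 = x₀
  feasible : ∀ k, U k ∈ F (x k)
  optimal : ∀ k, IsMinOn (d.cost Q R Qb (x k)) (F (x k)) (U k)
  step : ∀ k, x (k + 1) = d.Ad (x k) + d.Bd (U k ⟨0, hN⟩)

end DiscreteSystem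

end

end RegMPC

/-! Lyapunov equation. Put `Γ = C (δ - A)⁻¹`. On `D(A)` one has `C = Γ (δ - A)` and `(δ - A) A_d = δ
+ A`, so the polarization identity gives `‖C T(t) A_d x‖² - ‖C T(t) x‖² = d/dt (2δ ‖Γ T(t) x‖²)`.
Integrating over `[0, τ]` and telescoping along `A_d^j x` bounds `∑ ‖C_d A_d^j x‖²` by the
continuous output energy plus terms that vanish as `τ → ∞` by strong stability
(`InfiniteTimeAdmissible.sum_cayleyTustin_output_le`). Hence `Q̄ = ∑ (A_d^j)^* C_d^* Q C_d A_d^j`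
converges weakly and solves the equation. The difference `L` of two solutions satisfies `⟨L z, A z⟩
= 0` on `D(A)`; thus `⟨L T(t) z, T(t) z⟩` is constant, and it tends to `0`. Strong stability of the
powers of `A_d` is never needed.

MPC. By the Lyapunov equation, `J(U, x) + ⟨Q̄ x, x⟩` is the sum of the stage costs over the horizon
plus the terminal cost `⟨Q̄ x_N, x_N⟩` (`IsLyapunovSolution.cost_add`). Its value `W_k` along the
loop is a Lyapunov function: the shifted optimizer, filled up with a zero, is feasible at the next
state and costs no more. Uniform convexity, which comes from `R > 0`, turns this into `c ‖shift U_k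
- U_{k+1}‖² ≤ 2 (W_k - W_{k+1})`. The right side tends to `0`, and since `shift` is nilpotent the
whole sequence `U_k` tends to `0`. -/

namespace RegMPC

/-! ### Orbits in the domain of the generator, and its density. -/

section Semigroup

variable {X : Type*} [NormedAddCommGroup X] [NormedSpace ℝ X]

theorem C0Semigroup.op_add_apply (T : C0Semigroup X) (s t : ℝ≥0) (x : X) :
    T.op (s + t) x = T.op s (T.op t x) := by
  rw [T.op_add]
  rfl

theorem C0Semigroup.op_zero_apply (T : C0Semigroup X) (x : X) : T.op 0 x = x := by
  rw [T.op_zero]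
  rfl

theorem C0Semigroup.continuous_orbit_toNNReal (T : C0Semigroup X) (x : X) :
    Continuous fun t : ℝ => T.op t.toNNReal x :=
  (T.continuous_orbit x).comp continuous_real_toNNReal

theorem mem_graph_of_eq {A : X →ₗ.[ℝ] X} {x y : X} (h : (x, y) ∈ A.graph) :
    ∃ hx : x ∈ A.domain, A ⟨x, hx⟩ = y := by
  obtain ⟨z, hz, hz'⟩ := (LinearPMap.mem_graph_iff _).1 h
  obtain rfl : (z : X) = x := hz
  exact ⟨z.2, hz'⟩

theorem IsGenerator.apply_op {A : X →ₗ.[ℝ] X} {T : C0Semigroup X} (hA : IsGenerator A T)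
    (s : ℝ≥0) (x : A.domain) : A ⟨T.op s x, hA.op_mem s x⟩ = T.op s (A x) := by
  have h2 : ((T.op s x, T.op s (A x)) : X × X) ∈ A.graph := by
    rw [hA]
    refine (((T.op s).continuous.tendsto _).comp ((hA x (A x)).1 (A.mem_graph x))).congr
      fun t => ?_
    simp [map_sub, ← T.op_add_apply, add_comm s]
  exact (mem_graph_of_eq h2).2

theorem IsGenerator.hasDerivWithinAt_orbit {A : X →ₗ.[ℝ] X} {T : C0Semigroup X}
    (hA : IsGenerator A T) (x : A.domain) {t : ℝ} (ht : 0 ≤ t) :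
    HasDerivWithinAt (fun t : ℝ => T.op t.toNNReal x) (T.op t.toNNReal (A x)) (Set.Ici t) t := by
  rw [← hasDerivWithinAt_Ioi_iff_Ici, hasDerivWithinAt_iff_tendsto_slope' (by simp)]
  have h1 : Tendsto (fun s : ℝ => s - t) (𝓝[>] t) (𝓝[>] 0) := by
    refine tendsto_nhdsWithin_iff.2 ⟨?_, ?_⟩
    · have : Tendsto (fun s : ℝ => s - t) (𝓝 t) (𝓝 (t - t)) := tendsto_id.sub_const t
      rw [sub_self] at this
      exact this.mono_left nhdsWithin_le_nhds
    · filter_upwards [self_mem_nhdsWithin] with s hs using sub_pos.2 (Set.mem_Ioi.1 hs)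
  have h2 := (((T.op t.toNNReal).continuous.tendsto _).comp
    ((hA x (A x)).1 (A.mem_graph x))).comp h1
  refine h2.congr' ?_
  filter_upwards [self_mem_nhdsWithin] with s hs
  have hs' : t < s := hs
  have h3 : s.toNNReal = t.toNNReal + (s - t).toNNReal := by
    rw [← Real.toNNReal_add ht (sub_nonneg.2 hs'.le)]
    simp
  simp [slope_def_module, h3, T.op_add_apply, map_sub]

/-- The means `t⁻¹ ∫₀ᵗ T(s) x ds` lie in `D(A)` and converge to `x` as `t ↓ 0`. -/
theorem IsGenerator.dense_domain [CompleteSpace X] {A : X →ₗ.[ℝ] X} {T : C0Semigroup X}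
    (hA : IsGenerator A T) : Dense (A.domain : Set X) := by
  intro x
  set f : ℝ → X := fun t => T.op t.toNNReal x with hf
  have hfc : Continuous f := T.continuous_orbit_toNNReal x
  have hF (t : ℝ) : HasDerivAt (fun u => ∫ s in (0 : ℝ)..u, f s) (f t) t :=
    (hfc.integral_hasStrictDerivAt 0 t).hasDerivAt
  have hmem (t : ℝ) (ht : 0 ≤ t) : (∫ s in (0 : ℝ)..t, f s) ∈ A.domain := by
    suffices h : ((∫ s in (0 : ℝ)..t, f s, f t - f 0) : X × X) ∈ A.graph from
      (mem_graph_of_eq h).1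
    rw [hA]
    -- `T(r)` moves the window of integration from `[0, t]` to `[r, r + t]`, so the generator
    -- quotient is the slope of this function at `0`.
    have h1 : HasDerivAt (fun r => (∫ s in (0 : ℝ)..(r + t), f s) - ∫ s in (0 : ℝ)..r, f s)
        (f t - f 0) 0 := by
      refine HasDerivAt.sub ?_ (hF 0)
      have := hF (0 + t)
      simpa using this.comp_add_const 0 t
    have h2 := (hasDerivAt_iff_tendsto_slope.1 h1).mono_left
      (nhdsWithin_mono 0 (fun r (hr : 0 < r) => hr.ne'))
    refine h2.congr' ?_
    filter_upwards [self_mem_nhdsWithin] with r hr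
    have hr' : 0 < r := hr
    have h3 : T.op r.toNNReal (∫ s in (0 : ℝ)..t, f s) = ∫ s in r..(r + t), f s := by
      rw [← (T.op r.toNNReal).intervalIntegral_comp_comm (hfc.intervalIntegrable _ _),
        show (∫ s in r..(r + t), f s) = ∫ s in (0 + r)..(t + r), f s by rw [zero_add, add_comm r],
        ← intervalIntegral.integral_comp_add_right f r]
      refine intervalIntegral.integral_congr fun s hs => ?_
      rw [Set.uIcc_of_le ht] at hs
      simp only [hf]
      rw [Real.toNNReal_add hs.1 hr'.le, add_comm, T.op_add_apply]
    have h4 : (∫ s in (0 : ℝ)..(r + t), f s) - (∫ s in (0 : ℝ)..r, f s)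
        = ∫ s in r..(r + t), f s :=
      intervalIntegral.integral_interval_sub_left (hfc.intervalIntegrable _ _)
        (hfc.intervalIntegrable _ _)
    simp [slope_def_module, h3, h4]
  have hlim : Tendsto (fun t : ℝ => t⁻¹ • ∫ s in (0 : ℝ)..t, f s) (𝓝[>] 0) (𝓝 x) := by
    have h2 := (hasDerivAt_iff_tendsto_slope.1 (hF 0)).mono_left
      (nhdsWithin_mono 0 (fun r (hr : 0 < r) => hr.ne'))
    have h0 : f 0 = x := by simp [hf, T.op_zero_apply]
    rw [h0] at h2
    refine h2.congr fun r => ?_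
    simp [slope_def_module]
  refine mem_closure_of_tendsto hlim ?_
  filter_upwards [self_mem_nhdsWithin] with t ht
  have ht' : 0 < t := ht
  exact A.domain.smul_mem _ (hmem t ht'.le)

end Semigroup

/-! ### Output energy under the Cayley–Tustin transform. -/

namespace RegularSystem

variable {X : Type*} [NormedAddCommGroup X] [InnerProductSpace ℝ X] [CompleteSpace X] {m p : ℕ}

/-- The bounded operator `C (δ - A)⁻¹`. -/
noncomputable def resOutput (S : RegularSystem X m p) (δ : ℝ) : X →L[ℝ] Vec p :=
  (S.C ∘ₗ resToDomain S.A δ).mkContinuousOfExistsBound (S.C_res_bound δ)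

theorem resOutput_apply (S : RegularSystem X m p) (δ : ℝ) (x : X) :
    S.resOutput δ x = S.C (resToDomain S.A δ x) := rfl

theorem C_apply (S : RegularSystem X m p) {δ : ℝ} (hδ : δ ∈ resSet S.A) (x : S.A.domain) :
    S.C x = S.resOutput δ (δ • (x : X) - S.A x) := by
  rw [resOutput_apply]
  congr 1
  exact Subtype.ext ((resOp_spec hδ).left_inv x).symm

/-- Replaces the unbounded `C` by a bounded operator acting on an orbit, which makes the output
continuous in time. -/
theorem C_op_apply (S : RegularSystem X m p) {δ : ℝ} (hδ : δ ∈ resSet S.A) (t : ℝ≥0)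
    (x : S.A.domain) :
    S.C ⟨S.T.op t x, S.isGenerator.op_mem t x⟩
      = S.resOutput δ (S.T.op t (δ • (x : X) - S.A x)) := by
  rw [S.C_apply hδ, S.isGenerator.apply_op]
  simp only [map_sub, map_smul]

theorem cayleyTustin_Cd_apply (S : RegularSystem X m p) {δ : ℝ} (hδ : δ ∈ resSet S.A) (x : X) :
    (S.cayleyTustin δ hδ).Cd x = √(2 * δ) • S.resOutput δ x := rfl

theorem cayleyTustin_Ad_apply (S : RegularSystem X m p) {δ : ℝ} (hδ : δ ∈ resSet S.A) (x : X) :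
    (S.cayleyTustin δ hδ).Ad x = -x + (2 * δ) • resOp S.A δ x := rfl

theorem cayleyTustin_Ad_mem (S : RegularSystem X m p) {δ : ℝ} (hδ : δ ∈ resSet S.A)
    (x : S.A.domain) : (S.cayleyTustin δ hδ).Ad x ∈ S.A.domain := by
  rw [cayleyTustin_Ad_apply]
  exact S.A.domain.add_mem (S.A.domain.neg_mem x.2)
    (S.A.domain.smul_mem _ (resOp_mem S.A δ x))

theorem shift_cayleyTustin_Ad (S : RegularSystem X m p) {δ : ℝ} (hδ : δ ∈ resSet S.A)
    (x : S.A.domain) :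
    δ • (S.cayleyTustin δ hδ).Ad x
      - S.A ⟨(S.cayleyTustin δ hδ).Ad x, S.cayleyTustin_Ad_mem hδ x⟩ = δ • (x : X) + S.A x := by
  have h1 : (⟨(S.cayleyTustin δ hδ).Ad x, S.cayleyTustin_Ad_mem hδ x⟩ : S.A.domain)
      = -x + (2 * δ) • resToDomain S.A δ x := rfl
  have h2 := shift_resToDomain hδ δ x
  rw [sub_self, zero_smul, add_zero] at h2
  have h3 : S.A (resToDomain S.A δ x) = δ • (resToDomain S.A δ x : X) - x := by
    rw [eq_sub_iff_add_eq, add_comm]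
    exact (sub_eq_iff_eq_add.1 h2).symm
  rw [h1, LinearPMap.map_add, LinearPMap.map_neg, LinearPMap.map_smul, h3, cayleyTustin_Ad_apply]
  change _ - (_ + (2 * δ) • (δ • resOp S.A δ x - (x : X))) = _
  module

/-- `A_d (δ - A) x = (δ + A) x`. -/
theorem cayleyTustin_Ad_shift (S : RegularSystem X m p) {δ : ℝ} (hδ : δ ∈ resSet S.A)
    (x : S.A.domain) :
    (S.cayleyTustin δ hδ).Ad (δ • (x : X) - S.A x) = δ • (x : X) + S.A x := by
  rw [cayleyTustin_Ad_apply, (resOp_spec hδ).left_inv]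
  module

/-- The output energy `∫₀^τ ‖C T(t) x‖² dt`. -/
noncomputable def outputEnergy (S : RegularSystem X m p) (τ : ℝ) (x : S.A.domain) : ℝ :=
  ∫ t in (0 : ℝ)..τ, ‖S.C ⟨S.T.op t.toNNReal x, S.isGenerator.op_mem t.toNNReal x⟩‖ ^ 2

theorem outputEnergy_nonneg (S : RegularSystem X m p) {τ : ℝ} (hτ : 0 ≤ τ) (x : S.A.domain) :
    0 ≤ S.outputEnergy τ x :=
  intervalIntegral.integral_nonneg hτ fun _ _ => by positivity

/-- With `v = T(t) x` and `w = T(t) A x`, the integrands differ by `‖Γ(δv + w)‖² - ‖Γ(δv - w)‖² = 4δ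
⟨Γv, Γw⟩`, the right derivative of `2δ ‖Γ T(t) x‖²`. -/
theorem outputEnergy_cayleyTustin (S : RegularSystem X m p) {δ : ℝ} (hδ : δ ∈ resSet S.A)
    {τ : ℝ} (hτ : 0 ≤ τ) (x : S.A.domain) :
    S.outputEnergy τ ⟨(S.cayleyTustin δ hδ).Ad x, S.cayleyTustin_Ad_mem hδ x⟩
        - S.outputEnergy τ x
      = 2 * δ * ‖S.resOutput δ (S.T.op τ.toNNReal x)‖ ^ 2 - 2 * δ * ‖S.resOutput δ x‖ ^ 2 := by
  set Γ := S.resOutput δ with hΓ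
  have hc (v : X) : Continuous fun t : ℝ => Γ (S.T.op t.toNNReal v) :=
    Γ.continuous.comp (S.T.continuous_orbit_toNNReal v)
  have hd (t : ℝ) (ht : 0 ≤ t) :
      HasDerivWithinAt (fun t : ℝ => 2 * δ * ‖Γ (S.T.op t.toNNReal x)‖ ^ 2)
        (4 * δ * inner ℝ (Γ (S.T.op t.toNNReal x)) (Γ (S.T.op t.toNNReal (S.A x))))
        (Set.Ioi t) t := by
    have h1 := (Γ.hasFDerivAt.comp_hasDerivWithinAt t
      (S.isGenerator.hasDerivWithinAt_orbit x ht)).mono Set.Ioi_subset_Ici_self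
    refine ((h1.norm_sq).const_mul (2 * δ)).congr_deriv ?_
    simp only [Function.comp_apply]
    ring
  have hint := intervalIntegral.integral_eq_sub_of_hasDeriv_right (a := 0) (b := τ)
    (f := fun t : ℝ => 2 * δ * ‖Γ (S.T.op t.toNNReal x)‖ ^ 2)
    (((hc x).norm.pow 2).const_mul _).continuousOn
    (fun t ht => hd t (by rw [min_eq_left hτ] at ht; exact ht.1.le))
    ((continuous_const.mul ((hc x).inner (hc (S.A x)))).intervalIntegrable _ _)
  simp only [Real.toNNReal_zero, S.T.op_zero_apply] at hint
  have hi (v : X) : IntervalIntegrable (fun t : ℝ => ‖Γ (S.T.op t.toNNReal v)‖ ^ 2)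
      MeasureTheory.volume 0 τ := ((hc v).norm.pow 2).intervalIntegrable _ _
  have hE (v : S.A.domain) : S.outputEnergy τ v
      = ∫ t in (0 : ℝ)..τ, ‖Γ (S.T.op t.toNNReal (δ • (v : X) - S.A v))‖ ^ 2 := by
    simp only [outputEnergy, S.C_op_apply hδ, hΓ]
  rw [← hint, hE, hE, S.shift_cayleyTustin_Ad hδ, ← intervalIntegral.integral_sub (hi _) (hi _)]
  refine intervalIntegral.integral_congr fun t _ => ?_
  simp only [map_add, map_sub, map_smul]
  rw [norm_add_sq_real, norm_sub_sq_real, real_inner_smul_left]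
  ring

/-- The energy identity telescopes along `x, A_d x, A_d² x, …`; the last energy is nonnegative and
is dropped. -/
theorem sum_cayleyTustin_output_le_energy (S : RegularSystem X m p) {δ : ℝ} (hδ0 : 0 < δ)
    (hδ : δ ∈ resSet S.A) {τ : ℝ} (hτ : 0 ≤ τ) (n : ℕ) :
    ∀ x : S.A.domain, ∑ j ∈ Finset.range n,
        ‖(S.cayleyTustin δ hδ).Cd (((S.cayleyTustin δ hδ).Ad ^ j) x)‖ ^ 2
      ≤ S.outputEnergy τ x + ∑ j ∈ Finset.range n,
        2 * δ * ‖S.resOutput δ (S.T.op τ.toNNReal (((S.cayleyTustin δ hδ).Ad ^ j) x))‖ ^ 2 := by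
  induction n with
  | zero => intro x; simpa using S.outputEnergy_nonneg hτ x
  | succ n ih =>
    intro x
    have h1 := ih ⟨(S.cayleyTustin δ hδ).Ad x, S.cayleyTustin_Ad_mem hδ x⟩
    have h2 := S.outputEnergy_cayleyTustin hδ hτ x
    have h3 (j : ℕ) : ((S.cayleyTustin δ hδ).Ad ^ (j + 1)) (x : X)
        = ((S.cayleyTustin δ hδ).Ad ^ j) ((S.cayleyTustin δ hδ).Ad x) := by
      rw [pow_succ]; rfl
    rw [Finset.sum_range_succ', Finset.sum_range_succ']
    simp only [h3]
    have h4 : ‖(S.cayleyTustin δ hδ).Cd (((S.cayleyTustin δ hδ).Ad ^ 0) x)‖ ^ 2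
        = 2 * δ * ‖S.resOutput δ x‖ ^ 2 := by
      rw [pow_zero, one_apply_eq_self, cayleyTustin_Cd_apply, norm_smul, mul_pow,
        Real.norm_eq_abs, sq_abs, Real.sq_sqrt (by positivity)]
    rw [h4, pow_zero, one_apply_eq_self]
    linarith

theorem InfiniteTimeAdmissible.sum_cayleyTustin_output_le {S : RegularSystem X m p}
    (hadm : S.InfiniteTimeAdmissible) (hstable : S.T.StronglyStable) {δ : ℝ} (hδ0 : 0 < δ)
    (hδ : δ ∈ resSet S.A) :
    ∃ K : ℝ, 0 ≤ K ∧ ∀ (n : ℕ) (x : X), ∑ j ∈ Finset.range n,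
      ‖(S.cayleyTustin δ hδ).Cd (((S.cayleyTustin δ hδ).Ad ^ j) x)‖ ^ 2 ≤ K * ‖x‖ ^ 2 := by
  obtain ⟨K, hK⟩ := hadm
  refine ⟨|K|, abs_nonneg K, fun n x => ?_⟩
  have hdom (x : S.A.domain) : ∑ j ∈ Finset.range n,
      ‖(S.cayleyTustin δ hδ).Cd (((S.cayleyTustin δ hδ).Ad ^ j) x)‖ ^ 2
        ≤ |K| * ‖(x : X)‖ ^ 2 := by
    -- For fixed `n` the remainder is a finite sum, so strong stability removes it as `τ → ∞`, and
    -- the bound left over is independent of `n`.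
    have hlim : Tendsto (fun τ : ℝ => |K| * ‖(x : X)‖ ^ 2 + ∑ j ∈ Finset.range n,
        2 * δ * ‖S.resOutput δ (S.T.op τ.toNNReal (((S.cayleyTustin δ hδ).Ad ^ j) x))‖ ^ 2)
        atTop (𝓝 (|K| * ‖(x : X)‖ ^ 2 + ∑ j ∈ Finset.range n, 2 * δ * ‖(0 : Vec p)‖ ^ 2)) := by
      refine tendsto_const_nhds.add (tendsto_finsetSum _ fun j _ => ?_)
      refine Tendsto.const_mul _ (Tendsto.pow (Tendsto.norm ?_) 2)
      rw [← map_zero (S.resOutput δ)]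
      exact ((S.resOutput δ).continuous.tendsto _).comp
        ((hstable _).comp tendsto_real_toNNReal_atTop)
    simp only [norm_zero, ne_eq, OfNat.ofNat_ne_zero, not_false_eq_true, zero_pow, mul_zero,
      Finset.sum_const_zero, add_zero] at hlim
    refine ge_of_tendsto hlim ?_
    filter_upwards [eventually_gt_atTop 0] with τ hτ
    refine (S.sum_cayleyTustin_output_le_energy hδ0 hδ hτ.le n x).trans ?_
    gcongr
    exact (hK τ hτ x).trans (by gcongr; exact le_abs_self K)
  refine S.isGenerator.dense_domain.induction (fun x hx => hdom ⟨x, hx⟩) ?_ x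
  refine isClosed_le ?_ (by fun_prop)
  fun_prop

end RegularSystem

/-! ### Existence for the Lyapunov equation through `ℓ²`. -/

section SquareSummable

variable {X Y : Type*} [NormedAddCommGroup X] [InnerProductSpace ℝ X]
  [NormedAddCommGroup Y] [InnerProductSpace ℝ Y]

theorem exists_clm_lp_two (c : ℕ → X →L[ℝ] Y) {K : ℝ} (hK : 0 ≤ K)
    (hc : ∀ (n : ℕ) (x : X), ∑ j ∈ Finset.range n, ‖c j x‖ ^ 2 ≤ K * ‖x‖ ^ 2) :
    ∃ Ψ : X →L[ℝ] lp (fun _ : ℕ => Y) 2, ∀ x j, Ψ x j = c j x := by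
  have hmem (x : X) : Memℓp (fun j => c j x) 2 := by
    refine memℓp_gen ?_
    simp only [ENNReal.toReal_ofNat, Real.rpow_ofNat]
    exact summable_of_sum_range_le (fun _ => by positivity) fun n => hc n x
  let L : X →ₗ[ℝ] lp (fun _ : ℕ => Y) 2 :=
    { toFun := fun x => ⟨fun j => c j x, hmem x⟩
      map_add' := fun x y => by
        apply lp.ext
        funext j
        exact map_add (c j) x y
      map_smul' := fun r x => by
        apply lp.ext
        funext j
        exact map_smul (c j) r x }
  refine ⟨L.mkContinuous (√K) fun x => ?_, fun x j => rfl⟩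
  have h1 : ‖L x‖ ^ 2 ≤ K * ‖x‖ ^ 2 := by
    have h2 := lp.hasSum_norm (p := 2) (by norm_num) (L x)
    simp only [ENNReal.toReal_ofNat, Real.rpow_ofNat] at h2
    rw [← h2.tsum_eq]
    exact Real.tsum_le_of_sum_range_le (fun _ => by positivity) fun n => hc n x
  refine le_of_sq_le_sq ?_ (by positivity)
  rwa [mul_pow, Real.sq_sqrt hK]

end SquareSummable

namespace DiscreteSystem

variable {X : Type*} [NormedAddCommGroup X] [InnerProductSpace ℝ X] [CompleteSpace X] {m p : ℕ}

open ContinuousLinearMap (adjoint)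

theorem isLyapunovSolution_iff (d : DiscreteSystem X m p) (Q : Vec p →L[ℝ] Vec p)
    (Qb : X →L[ℝ] X) : d.IsLyapunovSolution Q Qb ↔ Qb.IsPositive ∧
      ∀ x y, inner ℝ (Qb (d.Ad x)) (d.Ad y) + inner ℝ (Q (d.Cd x)) (d.Cd y)
        = inner ℝ (Qb x) y := by
  refine and_congr_right fun _ => ⟨fun h x y => ?_, fun h => ?_⟩
  · have h1 := congrArg (fun L : X →L[ℝ] X => inner ℝ (L x) y) h
    simp only [sub_apply, neg_apply,
      ContinuousLinearMap.comp_apply, inner_sub_left, inner_neg_left,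
      ContinuousLinearMap.adjoint_inner_left] at h1
    linarith
  · refine ContinuousLinearMap.ext fun x => ext_inner_right ℝ fun y => ?_
    simp only [sub_apply, neg_apply,
      ContinuousLinearMap.comp_apply, inner_sub_left, inner_neg_left,
      ContinuousLinearMap.adjoint_inner_left]
    linarith [h x y]

/-- The solution is `Ψ^* Φ`, with `Ψ x = (C_d A_d^j x)_j` and `Φ x = (Q C_d A_d^j x)_j` in `ℓ²`.
Symmetry and positivity are inherited termwise from `Q`. -/
theorem exists_isLyapunovSolution (d : DiscreteSystem X m p) {Q : Vec p →L[ℝ] Vec p}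
    (hQ : Q.IsPositive) {K : ℝ} (hK : 0 ≤ K)
    (hd : ∀ (n : ℕ) (x : X), ∑ j ∈ Finset.range n, ‖d.Cd ((d.Ad ^ j) x)‖ ^ 2 ≤ K * ‖x‖ ^ 2) :
    ∃ Qb : X →L[ℝ] X, d.IsLyapunovSolution Q Qb := by
  obtain ⟨Ψ, hΨ⟩ := exists_clm_lp_two (fun j => d.Cd ∘L d.Ad ^ j) hK hd
  obtain ⟨Φ, hΦ⟩ := exists_clm_lp_two (fun j => Q ∘L d.Cd ∘L d.Ad ^ j) (K := ‖Q‖ ^ 2 * K)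
    (by positivity) fun n x => by
      rw [mul_assoc]
      refine le_trans ?_ (mul_le_mul_of_nonneg_left (hd n x) (by positivity))
      rw [Finset.mul_sum]
      refine Finset.sum_le_sum fun j _ => ?_
      rw [← mul_pow]
      gcongr
      exact Q.le_opNorm _
  have hs (x y : X) : HasSum
      (fun j => inner ℝ (Q (d.Cd ((d.Ad ^ j) x))) (d.Cd ((d.Ad ^ j) y)))
      (inner ℝ ((adjoint Ψ ∘L Φ) x) y) := by
    rw [ContinuousLinearMap.comp_apply, ContinuousLinearMap.adjoint_inner_left]
    have := lp.hasSum_inner (𝕜 := ℝ) (Φ x) (Ψ y)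
    simpa only [hΨ, hΦ, ContinuousLinearMap.comp_apply] using this
  refine ⟨adjoint Ψ ∘L Φ, (d.isLyapunovSolution_iff Q _).2
    ⟨ContinuousLinearMap.isPositive_def.2 ⟨fun x y => ?_, fun x => ?_⟩, fun x y => ?_⟩⟩
  · change inner ℝ ((adjoint Ψ ∘L Φ) x) y = inner ℝ x ((adjoint Ψ ∘L Φ) y)
    rw [real_inner_comm ((adjoint Ψ ∘L Φ) y)]
    refine (hs x y).unique ?_
    convert hs y x using 2 with j
    rw [real_inner_comm]
    exact (hQ.isSymmetric _ _).symm
  · exact (hs x x).nonneg fun j => hQ.inner_nonneg_left _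
  -- The series at `(A_d x, A_d y)` is the series at `(x, y)` without its term `j = 0`; this is the
  -- Lyapunov equation.
  · have h1 := (hasSum_nat_add_iff' 1).2 (hs x y)
    simp only [pow_succ, mul_apply_eq_comp, Finset.sum_range_one, pow_zero,
      one_apply_eq_self] at h1
    linarith [(hs (d.Ad x) (d.Ad y)).unique h1]

end DiscreteSystem

/-! ### Uniqueness for the Lyapunov equation. -/

namespace RegularSystem

variable {X : Type*} [NormedAddCommGroup X] [InnerProductSpace ℝ X] [CompleteSpace X] {m p : ℕ}

theorem isLyapunovSolution_unique (S : RegularSystem X m p) (hstable : S.T.StronglyStable)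
    {δ : ℝ} (hδ0 : 0 < δ) (hδ : δ ∈ resSet S.A) {Q : Vec p →L[ℝ] Vec p} {P₁ P₂ : X →L[ℝ] X}
    (h₁ : (S.cayleyTustin δ hδ).IsLyapunovSolution Q P₁)
    (h₂ : (S.cayleyTustin δ hδ).IsLyapunovSolution Q P₂) : P₁ = P₂ := by
  rw [DiscreteSystem.isLyapunovSolution_iff] at h₁ h₂
  set L : X →L[ℝ] X := P₁ - P₂ with hL
  have hsymm : (L : X →ₗ[ℝ] X).IsSymmetric := h₁.1.isSymmetric.sub h₂.1.isSymmetric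
  have hinv (x : X) : inner ℝ (L ((S.cayleyTustin δ hδ).Ad x)) ((S.cayleyTustin δ hδ).Ad x)
      = inner ℝ (L x) x := by
    simp only [hL, sub_apply, inner_sub_left]
    linarith [h₁.2 x x, h₂.2 x x]
  have horth (z : S.A.domain) : inner ℝ (L z) (S.A z) = 0 := by
    -- Inserting `(δ - A) z` turns invariance under `A_d` into `⟨L(δ + A)z, (δ + A)z⟩ = ⟨L(δ - A)z,
    -- (δ - A)z⟩`, where only the mixed terms survive.
    have h1 := hinv (δ • (z : X) - S.A z)
    rw [S.cayleyTustin_Ad_shift] at h1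
    have h2 : inner ℝ (L (S.A z)) (z : X) = inner ℝ (L z) (S.A z) := by
      rw [real_inner_comm]; exact (hsymm z (S.A z)).symm
    simp only [map_add, map_sub, map_smul, inner_add_left, inner_add_right, inner_sub_left,
      inner_sub_right, real_inner_smul_left, real_inner_smul_right, h2] at h1
    have h3 : δ * inner ℝ (L z) (S.A z) = 0 := by linarith
    exact (mul_eq_zero.1 h3).resolve_left hδ0.ne'
  have hzero (z : S.A.domain) : inner ℝ (L z) (z : X) = 0 := by
    have hc : Continuous fun t : ℝ =>
        inner ℝ (L (S.T.op t.toNNReal z)) (S.T.op t.toNNReal z) :=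
      (L.continuous.comp (S.T.continuous_orbit_toNNReal z)).inner
        (S.T.continuous_orbit_toNNReal z)
    have hconst (τ : ℝ) (hτ : 0 ≤ τ) :
        inner ℝ (L (S.T.op τ.toNNReal z)) (S.T.op τ.toNNReal z) = inner ℝ (L z) (z : X) := by
      have := constant_of_has_deriv_right_zero (a := 0) (b := τ) hc.continuousOn
        (fun t ht => ?_) τ ⟨hτ, le_rfl⟩
      · simpa [S.T.op_zero_apply] using this
      · have h1 := S.isGenerator.hasDerivWithinAt_orbit z ht.1
        have h2 := (L.hasFDerivAt.comp_hasDerivWithinAt t h1).inner ℝ h1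
        refine h2.congr_deriv ?_
        have h3 := horth ⟨S.T.op t.toNNReal z, S.isGenerator.op_mem t.toNNReal z⟩
        rw [S.isGenerator.apply_op] at h3
        have h4 := hsymm (S.T.op t.toNNReal (S.A z)) (S.T.op t.toNNReal z)
        rw [real_inner_comm] at h4
        simp only [ContinuousLinearMap.coe_coe] at h3 h4
        rw [Function.comp_apply, h3, zero_add, real_inner_comm, h4, real_inner_comm, h3]
    have hlim : Tendsto (fun t : ℝ =>
        inner ℝ (L (S.T.op t.toNNReal z)) (S.T.op t.toNNReal z)) atTop (𝓝 0) := by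
      have h1 := (hstable z).comp tendsto_real_toNNReal_atTop
      have h2 := Filter.Tendsto.inner (𝕜 := ℝ) ((L.continuous.tendsto 0).comp h1) h1
      simpa using h2
    refine tendsto_nhds_unique (tendsto_const_nhds.congr' ?_) hlim
    filter_upwards [eventually_ge_atTop 0] with τ hτ using (hconst τ hτ).symm
  have hall (x : X) : inner ℝ (L x) x = 0 :=
    S.isGenerator.dense_domain.induction (fun x hx => hzero ⟨x, hx⟩)
      (isClosed_eq (by fun_prop) continuous_const) x
  have h0 := hsymm.inner_map_self_eq_zero.1 hall
  refine sub_eq_zero.1 (ContinuousLinearMap.coe_injective ?_)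
  exact h0

theorem existsUnique_isLyapunovSolution (S : RegularSystem X m p)
    (hstable : S.T.StronglyStable) (hadm : S.InfiniteTimeAdmissible) {δ : ℝ} (hδ0 : 0 < δ)
    (hδ : δ ∈ resSet S.A) {Q : Vec p →L[ℝ] Vec p} (hQ : Q.IsPositive) :
    ∃! Qb : X →L[ℝ] X, (S.cayleyTustin δ hδ).IsLyapunovSolution Q Qb := by
  obtain ⟨K, hK, hd⟩ := hadm.sum_cayleyTustin_output_le hstable hδ0 hδ
  obtain ⟨Qb, hQb⟩ := (S.cayleyTustin δ hδ).exists_isLyapunovSolution hQ hK hd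
  exact ⟨Qb, hQb, fun P hP => S.isLyapunovSolution_unique hstable hδ0 hδ hP hQb⟩

end RegularSystem

/-! ### Midpoint convexity and closedness of the bounds; coercivity of `R`. -/

theorem ereal_le_midpoint {a : EReal} {r s : ℝ} (hr : a ≤ r) (hs : a ≤ s) :
    a ≤ ((1 / 2 * (r + s) : ℝ) : EReal) := by
  rcases le_total r s with h | h
  · exact hr.trans (EReal.coe_le_coe (by linarith))
  · exact hs.trans (EReal.coe_le_coe (by linarith))

theorem ereal_midpoint_le {a : EReal} {r s : ℝ} (hr : (r : EReal) ≤ a) (hs : (s : EReal) ≤ a) :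
    ((1 / 2 * (r + s) : ℝ) : EReal) ≤ a := by
  rcases le_total r s with h | h
  · exact le_trans (EReal.coe_le_coe (by linarith)) hs
  · exact le_trans (EReal.coe_le_coe (by linarith)) hr

theorem Bounds.InputOK.midpoint {m p : ℕ} {b : Bounds m p} {u v : Vec m} (hu : b.InputOK u)
    (hv : b.InputOK v) : b.InputOK ((1 / 2 : ℝ) • (u + v)) := fun i =>
  ⟨ereal_le_midpoint (hu i).1 (hv i).1, ereal_midpoint_le (hu i).2 (hv i).2⟩

theorem Bounds.OutputOK.midpoint {m p : ℕ} {b : Bounds m p} {y z : Vec p} (hy : b.OutputOK y)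
    (hz : b.OutputOK z) : b.OutputOK ((1 / 2 : ℝ) • (y + z)) := fun i =>
  ⟨ereal_le_midpoint (hy i).1 (hz i).1, ereal_midpoint_le (hy i).2 (hz i).2⟩

theorem Bounds.isClosed_inputOK {m p : ℕ} (b : Bounds m p) : IsClosed {u | b.InputOK u} := by
  simp only [Bounds.InputOK, Set.ofPred_forall, Set.ofPred_and]
  have h (i : Fin m) : Continuous fun u : Vec m => ((u i : ℝ) : EReal) :=
    continuous_coe_real_ereal.comp (by fun_prop)
  exact isClosed_iInter fun i =>
    (isClosed_le continuous_const (h i)).inter (isClosed_le (h i) continuous_const)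

theorem Bounds.isClosed_outputOK {m p : ℕ} (b : Bounds m p) : IsClosed {y | b.OutputOK y} := by
  simp only [Bounds.OutputOK, Set.ofPred_forall, Set.ofPred_and]
  have h (i : Fin p) : Continuous fun y : Vec p => ((y i : ℝ) : EReal) :=
    continuous_coe_real_ereal.comp (by fun_prop)
  exact isClosed_iInter fun i =>
    (isClosed_le continuous_const (h i)).inter (isClosed_le (h i) continuous_const)

/-- A positive definite quadratic form on a finite-dimensional space is coercive. -/
theorem exists_coercive_of_pos {E : Type*} [NormedAddCommGroup E] [InnerProductSpace ℝ E]
    [FiniteDimensional ℝ E] {R : E →L[ℝ] E} (hR : ∀ u, u ≠ 0 → 0 < inner ℝ (R u) u) :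
    ∃ c : ℝ, 0 < c ∧ ∀ u, c * ‖u‖ ^ 2 ≤ inner ℝ (R u) u := by
  have : ProperSpace E := FiniteDimensional.proper ℝ E
  rcases (Metric.sphere (0 : E) 1).eq_empty_or_nonempty with he | hne
  · refine ⟨1, one_pos, fun u => ?_⟩
    obtain rfl : u = 0 := by
      by_contra hu
      have : ‖u‖⁻¹ • u ∈ Metric.sphere (0 : E) 1 := by
        simp [norm_smul, norm_ne_zero_iff.2 hu]
      rw [he] at this
      exact this
    simp
  · have hc : Continuous fun u : E => inner ℝ (R u) u := by fun_prop
    obtain ⟨v, hv, hmin⟩ := (isCompact_sphere (0 : E) 1).exists_isMinOn hne hc.continuousOn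
    have hv1 : ‖v‖ = 1 := by simpa using hv
    refine ⟨inner ℝ (R v) v, hR v (norm_ne_zero_iff.1 (by simp [hv1])), fun u => ?_⟩
    rcases eq_or_ne u 0 with rfl | hu
    · simp
    have hu' : ‖u‖ ≠ 0 := norm_ne_zero_iff.2 hu
    have h1 : inner ℝ (R v) v ≤ inner ℝ (R (‖u‖⁻¹ • u)) (‖u‖⁻¹ • u) :=
      hmin (by simp [norm_smul, hu'])
    rw [map_smul, real_inner_smul_left, real_inner_smul_right] at h1
    calc _ ≤ ‖u‖⁻¹ * (‖u‖⁻¹ * inner ℝ (R u) u) * ‖u‖ ^ 2 := by gcongr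
      _ = _ := by field_simp

theorem sum_range_sum_range_of_symm (a : ℕ → ℕ → ℝ) (ha : ∀ i j, a i j = a j i) (N : ℕ) :
    ∑ i ∈ Finset.range N, ∑ j ∈ Finset.range N, a i j
      = ∑ i ∈ Finset.range N, (a i i + 2 * ∑ j ∈ Finset.range i, a i j) := by
  induction N with
  | zero => simp
  | succ N ih =>
    rw [Finset.sum_range_succ _ N, Finset.sum_range_succ _ N, Finset.sum_range_succ _ N, ← ih]
    simp only [Finset.sum_range_succ _ N, Finset.sum_add_distrib]
    simp only [ha _ N]
    ring

/-! ### Trajectories, the shift and recursive feasibility. -/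

namespace DiscreteSystem

variable {X : Type*} [NormedAddCommGroup X] [InnerProductSpace ℝ X] {m p : ℕ}

theorem zeroExt_of_le {N n : ℕ} (U : Fin N → Vec m) (h : N ≤ n) : zeroExt U n = 0 :=
  dif_neg h.not_gt

theorem zeroExt_fin {N : ℕ} (U : Fin N → Vec m) (i : Fin N) : zeroExt U i = U i := by
  simp [zeroExt]

theorem zeroExt_midpoint {N : ℕ} (U V : Fin N → Vec m) (n : ℕ) :
    zeroExt ((1 / 2 : ℝ) • (U + V)) n = (1 / 2 : ℝ) • (zeroExt U n + zeroExt V n) := by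
  by_cases h : n < N <;> simp [zeroExt, h]

theorem continuous_zeroExt {N : ℕ} (n : ℕ) :
    Continuous fun U : Fin N → Vec m => zeroExt U n := by
  by_cases h : n < N
  · simpa [zeroExt, h] using continuous_apply _
  · simpa [zeroExt, h] using continuous_const

theorem sum_fin_eq_sum_range_zeroExt {N : ℕ} (U : Fin N → Vec m) (f : ℕ → Vec m → ℝ) :
    ∑ i : Fin N, f i (U i) = ∑ n ∈ Finset.range N, f n (zeroExt U n) := by
  rw [← Fin.sum_univ_eq_sum_range]
  simp only [zeroExt_fin]

/-- The input sequence without its first element, continued by a zero input. -/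
def shift {N : ℕ} (U : Fin N → Vec m) : Fin N → Vec m := fun i => zeroExt U (i + 1)

theorem zeroExt_shift {N : ℕ} (U : Fin N → Vec m) (n : ℕ) :
    zeroExt (shift U) n = zeroExt U (n + 1) := by
  by_cases h : n < N
  · simp [zeroExt, shift, h]
  · rw [zeroExt_of_le _ (not_lt.1 h), zeroExt_of_le _ (by omega)]

theorem state_succ' (d : DiscreteSystem X m p) (x : X) (u : ℕ → Vec m) (n : ℕ) :
    d.state x u (n + 1) = d.state (d.Ad x + d.Bd (u 0)) (fun k => u (k + 1)) n := by
  induction n with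
  | zero => rfl
  | succ n ih => rw [state, ih, state]

theorem state_eq_sum (d : DiscreteSystem X m p) (x : X) (u : ℕ → Vec m) (n : ℕ) :
    d.state x u n = (d.Ad ^ n) x
      + ∑ j ∈ Finset.range n, (d.Ad ^ (n - j - 1)) (d.Bd (u j)) := by
  induction n with
  | zero => simp [state]
  | succ n ih =>
    rw [state, ih, Finset.sum_range_succ, map_add, map_sum, pow_succ', add_assoc]
    congr 2
    · refine Finset.sum_congr rfl fun j hj => ?_
      rw [show n + 1 - j - 1 = (n - j - 1) + 1 by have := Finset.mem_range.1 hj; omega, pow_succ']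
      rfl
    · simp

theorem state_midpoint (d : DiscreteSystem X m p) (x : X) (u v : ℕ → Vec m) (n : ℕ) :
    d.state x (fun k => (1 / 2 : ℝ) • (u k + v k)) n
      = (1 / 2 : ℝ) • (d.state x u n + d.state x v n) := by
  induction n with
  | zero => simp only [state]; module
  | succ n ih =>
    simp only [state, ih, map_add, map_smul]
    module

theorem continuous_state_zeroExt (d : DiscreteSystem X m p) (x : X) {N : ℕ} (n : ℕ) :
    Continuous fun U : Fin N → Vec m => d.state x (zeroExt U) n := by
  induction n with
  | zero => exact continuous_const
  | succ n ih =>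
    exact (d.Ad.continuous.comp ih).add (d.Bd.continuous.comp (continuous_zeroExt n))

theorem BoundsHoldAt.midpoint {d : DiscreteSystem X m p} {b : Bounds m p} {N : ℕ} {x : X}
    {U V : Fin N → Vec m} {n : ℕ} (hU : d.BoundsHoldAt b x U n) (hV : d.BoundsHoldAt b x V n) :
    d.BoundsHoldAt b x ((1 / 2 : ℝ) • (U + V)) n := by
  have h1 : zeroExt ((1 / 2 : ℝ) • (U + V))
      = fun k => (1 / 2 : ℝ) • (zeroExt U k + zeroExt V k) := funext (zeroExt_midpoint U V)
  rw [BoundsHoldAt, h1]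
  refine ⟨hU.1.midpoint hV.1, ?_⟩
  have h2 := hU.2.midpoint hV.2
  rw [state_midpoint]
  convert h2 using 1
  simp only [map_add, map_smul]
  module

theorem boundsHoldAt_shift_iff {d : DiscreteSystem X m p} {b : Bounds m p} {N : ℕ} (hN : 0 < N)
    {x : X} {U : Fin N → Vec m} {n : ℕ} :
    d.BoundsHoldAt b (d.Ad x + d.Bd (U ⟨0, hN⟩)) (shift U) n ↔ d.BoundsHoldAt b x U (n + 1) := by
  have h0 : zeroExt U 0 = U ⟨0, hN⟩ := zeroExt_fin U ⟨0, hN⟩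
  rw [BoundsHoldAt, BoundsHoldAt, zeroExt_shift, state_succ', h0, funext (zeroExt_shift U)]

theorem isClosed_setOf_boundsHoldAt (d : DiscreteSystem X m p) (b : Bounds m p) {N : ℕ} (x : X)
    (n : ℕ) : IsClosed {U : Fin N → Vec m | d.BoundsHoldAt b x U n} := by
  refine (b.isClosed_inputOK.preimage (continuous_zeroExt n)).inter
    (b.isClosed_outputOK.preimage
      (f := fun U : Fin N → Vec m => d.Cd (d.state x (zeroExt U) n) + d.Dd (zeroExt U n)) ?_)
  exact (d.Cd.continuous.comp (d.continuous_state_zeroExt x n)).add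
    (d.Dd.continuous.comp (continuous_zeroExt n))

theorem isClosed_allTimeFeasible (d : DiscreteSystem X m p) (b : Bounds m p) (N : ℕ) (x : X) :
    IsClosed (d.allTimeFeasible b N x) := by
  rw [allTimeFeasible, Set.ofPred_forall]
  exact isClosed_iInter fun n => d.isClosed_setOf_boundsHoldAt b x n

/-- Variation of constants identifies `S U + T x` with the output trajectory, so both constraint
sets can be handled through `BoundsHoldAt`. -/
theorem mem_horizonFeasible_iff (d : DiscreteSystem X m p) (b : Bounds m p) {N : ℕ} (x : X)
    (U : Fin N → Vec m) :
    U ∈ d.horizonFeasible b N x ↔ ∀ n < N, d.BoundsHoldAt b x U n := by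
  have hout (i : Fin N) : (∑ j, d.matS i j (U j)) + d.matT i x
      = d.Cd (d.state x (zeroExt U) i) + d.Dd (zeroExt U i) := by
    let f : ℕ → Vec p := fun j => if (i : ℕ) = j then d.Dd (zeroExt U j)
      else if j < i then d.Cd ((d.Ad ^ ((i : ℕ) - j - 1)) (d.Bd (zeroExt U j))) else 0
    have h1 (j : Fin N) : d.matS i j (U j) = f j := by
      simp only [matS, f, zeroExt_fin, Fin.ext_iff, Fin.lt_def]
      split_ifs <;> rfl
    have h2 : ∑ j ∈ Finset.range N, f j = ∑ j ∈ Finset.range (i + 1), f j := by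
      symm
      refine Finset.sum_subset (fun j hj => ?_) fun j _ hj => ?_
      · have := Finset.mem_range.1 hj
        exact Finset.mem_range.2 (by omega)
      · have hj' : ¬ j < i + 1 := fun h => hj (Finset.mem_range.2 h)
        simp only [f]
        rw [if_neg (by omega), if_neg (by omega)]
    have h3 : ∑ j ∈ Finset.range i, f j
        = ∑ j ∈ Finset.range i, d.Cd ((d.Ad ^ ((i : ℕ) - j - 1)) (d.Bd (zeroExt U j))) := by
      refine Finset.sum_congr rfl fun j hj => ?_
      have := Finset.mem_range.1 hj
      simp only [f]
      rw [if_neg (by omega), if_pos this]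
    have h4 : f i = d.Dd (zeroExt U i) := if_pos rfl
    simp only [h1]
    rw [Fin.sum_univ_eq_sum_range, h2, Finset.sum_range_succ, h3, h4, state_eq_sum, map_add,
      map_sum, matT, ContinuousLinearMap.comp_apply]
    abel
  constructor
  · intro h n hn
    have := h ⟨n, hn⟩
    rw [hout, ← zeroExt_fin U] at this
    exact this
  · intro h i
    rw [hout, ← zeroExt_fin U]
    exact h i i.2

theorem shift_mem_allTimeFeasible {d : DiscreteSystem X m p} {b : Bounds m p} {N : ℕ}
    (hN : 0 < N) {x : X} {U : Fin N → Vec m} (hU : U ∈ d.allTimeFeasible b N x) :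
    shift U ∈ d.allTimeFeasible b N (d.Ad x + d.Bd (U ⟨0, hN⟩)) := fun n =>
  (boundsHoldAt_shift_iff hN).2 (hU (n + 1))

theorem shift_mem_horizonFeasible {d : DiscreteSystem X m p} {b : Bounds m p} {N : ℕ}
    (hN : 0 < N) {x : X} {U : Fin N → Vec m} (hU : U ∈ d.horizonFeasible b N x)
    (hU' : d.BoundsHoldAt b x U N) :
    shift U ∈ d.horizonFeasible b N (d.Ad x + d.Bd (U ⟨0, hN⟩)) := by
  rw [mem_horizonFeasible_iff] at hU ⊢
  intro n hn
  rw [boundsHoldAt_shift_iff]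
  -- Step `n` of the shifted problem is step `n + 1` of the old one. Only `n + 1 = N` leaves the
  -- horizon, and there the extra assumption enters.
  rcases (Nat.succ_le_of_lt hn).lt_or_eq with h | h
  · exact hU _ h
  · have h' : n + 1 = N := h
    rwa [h']

/-- The cost `⟨Q y, y⟩ + ⟨R u, u⟩` of one step. -/
noncomputable def stageCost (d : DiscreteSystem X m p) (Q : Vec p →L[ℝ] Vec p)
    (R : Vec m →L[ℝ] Vec m) (x : X) (u : Vec m) : ℝ :=
  inner ℝ (Q (d.Cd x + d.Dd u)) (d.Cd x + d.Dd u) + inner ℝ (R u) u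

theorem le_stageCost (d : DiscreteSystem X m p) {Q : Vec p →L[ℝ] Vec p} (hQ : Q.IsPositive)
    (R : Vec m →L[ℝ] Vec m) (x : X) (u : Vec m) : inner ℝ (R u) u ≤ d.stageCost Q R x u :=
  le_add_of_nonneg_left (hQ.inner_nonneg_left _)

/-! ### The cost as a sum of stage costs. -/

variable [CompleteSpace X]

open ContinuousLinearMap (adjoint)

/-- The operator `D_d^* Q C_d + B_d^* Qb A_d`. -/
noncomputable def crossGain (d : DiscreteSystem X m p) (Q : Vec p →L[ℝ] Vec p)
    (Qb : X →L[ℝ] X) : X →L[ℝ] Vec m :=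
  adjoint d.Dd ∘L Q ∘L d.Cd + adjoint d.Bd ∘L Qb ∘L d.Ad

theorem matP_apply (d : DiscreteSystem X m p) (Q : Vec p →L[ℝ] Vec p) (Qb : X →L[ℝ] X) {N : ℕ}
    (i : Fin N) (x : X) : d.matP Q Qb i x = d.crossGain Q Qb ((d.Ad ^ (i : ℕ)) x) := by
  rw [matP, pow_succ']
  rfl

theorem blockH_succ_apply (d : DiscreteSystem X m p) (Q : Vec p →L[ℝ] Vec p)
    (R : Vec m →L[ℝ] Vec m) (Qb : X →L[ℝ] X) (n : ℕ) (u : Vec m) :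
    d.blockH Q R Qb (n + 1) u = d.crossGain Q Qb ((d.Ad ^ n) (d.Bd u)) := by
  rw [blockH, pow_succ']
  rfl

/-- After expansion, the Lyapunov equation collapses the terms quadratic in `x` to `⟨Qb x, x⟩`.
Summed along a trajectory, this is the telescoping behind `cost_add`. -/
theorem IsLyapunovSolution.stageCost_add {d : DiscreteSystem X m p} {Q : Vec p →L[ℝ] Vec p}
    (hQ : Q.IsPositive) {Qb : X →L[ℝ] X} (hL : d.IsLyapunovSolution Q Qb)
    (R : Vec m →L[ℝ] Vec m) (x : X) (u : Vec m) :
    d.stageCost Q R x u + inner ℝ (Qb (d.Ad x + d.Bd u)) (d.Ad x + d.Bd u)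
      = inner ℝ (Qb x) x + inner ℝ u (d.blockH Q R Qb 0 u)
        + 2 * inner ℝ u (d.crossGain Q Qb x) := by
  rw [isLyapunovSolution_iff] at hL
  have h1 := hL.2 x x
  have h2 : inner ℝ (Q (d.Dd u)) (d.Cd x) = inner ℝ (d.Dd u) (Q (d.Cd x)) :=
    hQ.isSymmetric _ _
  have h3 : inner ℝ (Qb (d.Bd u)) (d.Ad x) = inner ℝ (d.Bd u) (Qb (d.Ad x)) :=
    hL.1.isSymmetric _ _
  simp only [stageCost, blockH, crossGain, add_apply,
    ContinuousLinearMap.comp_apply, map_add, inner_add_left, inner_add_right,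
    ContinuousLinearMap.adjoint_inner_right, h2, h3]
  rw [real_inner_comm (d.Dd u) (Q (d.Cd x)), real_inner_comm (d.Dd u) (Q (d.Dd u)),
    real_inner_comm (d.Bd u) (Qb (d.Ad x)), real_inner_comm (d.Bd u) (Qb (d.Bd u)),
    real_inner_comm u (R u)]
  linarith

/-- The cost functional is the infinite-horizon cost up to `⟨Qb x, x⟩`. -/
theorem IsLyapunovSolution.cost_add {d : DiscreteSystem X m p} {Q : Vec p →L[ℝ] Vec p}
    (hQ : Q.IsPositive) {Qb : X →L[ℝ] X} (hL : d.IsLyapunovSolution Q Qb)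
    (R : Vec m →L[ℝ] Vec m) {N : ℕ} (x : X) (U : Fin N → Vec m) :
    d.cost Q R Qb x U + inner ℝ (Qb x) x
      = (∑ n ∈ Finset.range N, d.stageCost Q R (d.state x (zeroExt U) n) (zeroExt U n))
        + inner ℝ (Qb (d.state x (zeroExt U) N)) (d.state x (zeroExt U) N) := by
  set u := zeroExt U with hu
  set K := d.crossGain Q Qb with hK
  have htel (M : ℕ) : (∑ n ∈ Finset.range M, d.stageCost Q R (d.state x u n) (u n))
      + inner ℝ (Qb (d.state x u M)) (d.state x u M)
      = inner ℝ (Qb x) x + ∑ n ∈ Finset.range M, (inner ℝ (u n) (d.blockH Q R Qb 0 (u n))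
        + 2 * inner ℝ (u n) (K (d.state x u n))) := by
    induction M with
    | zero => simp [state]
    | succ M ih =>
      have h1 := hL.stageCost_add hQ R (d.state x u M) (u M)
      rw [Finset.sum_range_succ, Finset.sum_range_succ, state]
      linarith
  rw [htel, add_comm]
  congr 1
  let a : ℕ → ℕ → ℝ := fun i j => inner ℝ (u i)
    ((if j ≤ i then d.blockH Q R Qb (i - j) else adjoint (d.blockH Q R Qb (j - i))) (u j))
  have ha_symm (i j : ℕ) : a i j = a j i := by
    rcases lt_trichotomy i j with h | rfl | h
    · simp only [a, if_neg h.not_ge, if_pos h.le, ContinuousLinearMap.adjoint_inner_right]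
      rw [real_inner_comm]
    · rfl
    · simp only [a, if_neg h.not_ge, if_pos h.le, ContinuousLinearMap.adjoint_inner_right]
      rw [real_inner_comm]
  have h1 : ∑ i : Fin N, ∑ j : Fin N, inner ℝ (U i) (d.matH Q R Qb i j (U j))
      = ∑ i ∈ Finset.range N, ∑ j ∈ Finset.range N, a i j := by
    rw [← Fin.sum_univ_eq_sum_range (fun i => ∑ j ∈ Finset.range N, a i j)]
    refine Finset.sum_congr rfl fun i _ => ?_
    rw [← Fin.sum_univ_eq_sum_range]
    refine Finset.sum_congr rfl fun j _ => ?_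
    simp only [a, hu, zeroExt_fin]
    rfl
  have h2 : ∑ i : Fin N, inner ℝ (U i) (d.matP Q Qb i x)
      = ∑ i ∈ Finset.range N, inner ℝ (u i) (K ((d.Ad ^ i) x)) := by
    simp only [matP_apply]
    exact sum_fin_eq_sum_range_zeroExt U fun i v => inner ℝ v (K ((d.Ad ^ i) x))
  rw [cost, h1, h2, sum_range_sum_range_of_symm a ha_symm, Finset.mul_sum,
    ← Finset.sum_add_distrib]
  refine Finset.sum_congr rfl fun i _ => ?_
  have h3 : ∑ j ∈ Finset.range i, a i j
      = ∑ j ∈ Finset.range i, inner ℝ (u i) (K ((d.Ad ^ (i - j - 1)) (d.Bd (u j)))) := by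
    refine Finset.sum_congr rfl fun j hj => ?_
    have hj' := Finset.mem_range.1 hj
    simp only [a, if_pos hj'.le]
    rw [show i - j = (i - j - 1) + 1 by omega, blockH_succ_apply]
    rfl
  have h4 : a i i = inner ℝ (u i) (d.blockH Q R Qb 0 (u i)) := by simp [a]
  rw [h3, h4, d.state_eq_sum, map_add, map_sum, inner_add_right, inner_sum]
  ring

/-! ### Uniform convexity and coercivity of the cost. -/

theorem cost_midpoint (d : DiscreteSystem X m p) (Q : Vec p →L[ℝ] Vec p)
    (R : Vec m →L[ℝ] Vec m) (Qb : X →L[ℝ] X) {N : ℕ} (x : X) (U V : Fin N → Vec m) :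
    d.cost Q R Qb x ((1 / 2 : ℝ) • (U + V))
      = (d.cost Q R Qb x U + d.cost Q R Qb x V) / 2 - d.cost Q R Qb 0 (U - V) / 4 := by
  have h1 : ∑ i, ∑ j, inner ℝ (((1 / 2 : ℝ) • (U + V)) i)
        (d.matH Q R Qb i j (((1 / 2 : ℝ) • (U + V)) j))
      = ((∑ i, ∑ j, inner ℝ (U i) (d.matH Q R Qb i j (U j)))
        + ∑ i, ∑ j, inner ℝ (V i) (d.matH Q R Qb i j (V j))) / 2
        - (∑ i, ∑ j, inner ℝ ((U - V) i) (d.matH Q R Qb i j ((U - V) j))) / 4 := by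
    simp only [← Finset.sum_add_distrib, Finset.sum_div, ← Finset.sum_sub_distrib]
    refine Finset.sum_congr rfl fun i _ => Finset.sum_congr rfl fun j _ => ?_
    simp only [Pi.smul_apply, Pi.add_apply, Pi.sub_apply, map_add, map_sub, map_smul,
      inner_add_left, inner_add_right, inner_sub_left, inner_sub_right, real_inner_smul_left,
      real_inner_smul_right]
    ring
  have h2 : ∑ i, inner ℝ (((1 / 2 : ℝ) • (U + V)) i) (d.matP Q Qb i x)
      = ((∑ i, inner ℝ (U i) (d.matP Q Qb i x)) + ∑ i, inner ℝ (V i) (d.matP Q Qb i x)) / 2 := by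
    simp only [← Finset.sum_add_distrib, Finset.sum_div]
    refine Finset.sum_congr rfl fun i _ => ?_
    simp only [Pi.smul_apply, Pi.add_apply, inner_add_left, real_inner_smul_left]
    ring
  simp only [cost, h1, h2, map_zero, inner_zero_right, Finset.sum_const_zero]
  ring

/-- At `x = 0` the cost is the form `Uᵀ H U`; in its stage cost representation the output and
terminal terms are nonnegative, which leaves `R`. -/
theorem IsLyapunovSolution.le_cost_zero {d : DiscreteSystem X m p} {Q : Vec p →L[ℝ] Vec p}
    (hQ : Q.IsPositive) {Qb : X →L[ℝ] X} (hL : d.IsLyapunovSolution Q Qb)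
    {R : Vec m →L[ℝ] Vec m} {c : ℝ} (hc : 0 < c) (hR : ∀ u, c * ‖u‖ ^ 2 ≤ inner ℝ (R u) u)
    {N : ℕ} (U : Fin N → Vec m) : c * ‖U‖ ^ 2 ≤ d.cost Q R Qb 0 U := by
  have hR0 (u : Vec m) : 0 ≤ inner ℝ (R u) u := le_trans (by positivity) (hR u)
  have h1 := hL.cost_add hQ R 0 U
  rw [inner_zero_right, add_zero] at h1
  have h2 : ∑ i, inner ℝ (R (U i)) (U i) ≤ d.cost Q R Qb 0 U := by
    rw [h1, sum_fin_eq_sum_range_zeroExt U fun _ v => inner ℝ (R v) v]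
    exact le_add_of_le_of_nonneg (Finset.sum_le_sum fun n _ => d.le_stageCost hQ R _ _)
      (hL.1.inner_nonneg_left _)
  have h3 (i : Fin N) : ‖U i‖ ^ 2 ≤ d.cost Q R Qb 0 U / c := by
    rw [le_div_iff₀' hc]
    exact (hR _).trans ((Finset.single_le_sum (f := fun i => inner ℝ (R (U i)) (U i))
      (fun i _ => hR0 (U i)) (Finset.mem_univ i)).trans h2)
  have h0 : 0 ≤ d.cost Q R Qb 0 U := (Finset.sum_nonneg fun i _ => hR0 (U i)).trans h2
  have h4 : ‖U‖ ≤ √(d.cost Q R Qb 0 U / c) :=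
    (pi_norm_le_iff_of_nonneg (Real.sqrt_nonneg _)).2 fun i => Real.le_sqrt_of_sq_le (h3 i)
  rw [← le_div_iff₀' hc]
  exact (Real.le_sqrt (norm_nonneg _) (by positivity)).1 h4

/-- Compare the minimizer with the midpoint, which undercuts the average cost by a quarter of the
quadratic form at `U - V`. Gives both uniqueness of minimizers and the decay estimate of the closed
loop. -/
theorem norm_sq_sub_le_of_isMinOn {d : DiscreteSystem X m p} {Q : Vec p →L[ℝ] Vec p}
    (hQ : Q.IsPositive) {Qb : X →L[ℝ] X} (hL : d.IsLyapunovSolution Q Qb)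
    {R : Vec m →L[ℝ] Vec m} {c : ℝ} (hc : 0 < c) (hR : ∀ u, c * ‖u‖ ^ 2 ≤ inner ℝ (R u) u)
    {N : ℕ} {x : X} {F : Set (Fin N → Vec m)}
    (hF : ∀ U ∈ F, ∀ V ∈ F, (1 / 2 : ℝ) • (U + V) ∈ F) {U V : Fin N → Vec m}
    (hU : U ∈ F) (hV : V ∈ F) (hmin : IsMinOn (d.cost Q R Qb x) F V) :
    c * ‖U - V‖ ^ 2 ≤ 2 * (d.cost Q R Qb x U - d.cost Q R Qb x V) := by
  have h1 : d.cost Q R Qb x V ≤ d.cost Q R Qb x ((1 / 2 : ℝ) • (U + V)) := hmin (hF U hU V hV)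
  rw [cost_midpoint] at h1
  linarith [hL.le_cost_zero hQ hc hR (U - V)]

theorem continuous_cost (d : DiscreteSystem X m p) (Q : Vec p →L[ℝ] Vec p)
    (R : Vec m →L[ℝ] Vec m) (Qb : X →L[ℝ] X) {N : ℕ} (x : X) :
    Continuous fun U : Fin N → Vec m => d.cost Q R Qb x U := by
  unfold cost
  fun_prop

theorem tendsto_cost_cocompact {d : DiscreteSystem X m p} {Q : Vec p →L[ℝ] Vec p}
    (hQ : Q.IsPositive) {Qb : X →L[ℝ] X} (hL : d.IsLyapunovSolution Q Qb)
    {R : Vec m →L[ℝ] Vec m} {c : ℝ} (hc : 0 < c) (hR : ∀ u, c * ‖u‖ ^ 2 ≤ inner ℝ (R u) u)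
    {N : ℕ} (x : X) :
    Tendsto (fun U : Fin N → Vec m => d.cost Q R Qb x U) (cocompact _) atTop := by
  set ℓ : ℝ := ∑ i : Fin N, ‖d.matP Q Qb i x‖ with hℓ
  have hle (U : Fin N → Vec m) : ‖U‖ * (c * ‖U‖ - 2 * ℓ) ≤ d.cost Q R Qb x U := by
    have h1 : d.cost Q R Qb x U
        = d.cost Q R Qb 0 U + 2 * ∑ i, inner ℝ (U i) (d.matP Q Qb i x) := by
      simp [cost]
    have h2 : -(‖U‖ * ℓ) ≤ ∑ i, inner ℝ (U i) (d.matP Q Qb i x) := by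
      rw [hℓ, Finset.mul_sum, ← Finset.sum_neg_distrib]
      refine Finset.sum_le_sum fun i _ => ?_
      have h3 := (abs_le.1 (abs_real_inner_le_norm (U i) (d.matP Q Qb i x))).1
      have h4 : ‖U i‖ * ‖d.matP Q Qb i x‖ ≤ ‖U‖ * ‖d.matP Q Qb i x‖ := by
        gcongr
        exact norm_le_pi_norm U i
      linarith
    linarith [hL.le_cost_zero hQ hc hR U]
  refine tendsto_atTop_mono hle ?_
  have hn : Tendsto (fun U : Fin N → Vec m => ‖U‖) (cocompact _) atTop :=
    tendsto_norm_cocompact_atTop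
  exact hn.atTop_mul_atTop₀ (tendsto_atTop_add_const_right _ _ (hn.const_mul_atTop hc))

/-! ### Descent along the closed loop, convergence and well-posedness. -/

theorem IsLyapunovSolution.cost_shift_le {d : DiscreteSystem X m p} {Q : Vec p →L[ℝ] Vec p}
    (hQ : Q.IsPositive) {Qb : X →L[ℝ] X} (hL : d.IsLyapunovSolution Q Qb)
    {R : Vec m →L[ℝ] Vec m} (hR : R.IsPositive) {N : ℕ} (hN : 0 < N) (x : X)
    (U : Fin N → Vec m) {x' : X} (hx' : x' = d.Ad x + d.Bd (U ⟨0, hN⟩)) :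
    d.cost Q R Qb x' (shift U) + inner ℝ (Qb x') x' ≤ d.cost Q R Qb x U + inner ℝ (Qb x) x := by
  have h0 : zeroExt U 0 = U ⟨0, hN⟩ := zeroExt_fin U ⟨0, hN⟩
  have h1 (n : ℕ) : d.state x' (zeroExt (shift U)) n = d.state x (zeroExt U) (n + 1) := by
    rw [state_succ', h0, ← hx', funext (zeroExt_shift U)]
  rw [hL.cost_add hQ, hL.cost_add hQ]
  simp only [h1, zeroExt_shift]
  have h2 := hL.stageCost_add hQ R (d.state x (zeroExt U) N) (zeroExt U N)
  have h3 := Finset.sum_range_succ'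
    (fun n => d.stageCost Q R (d.state x (zeroExt U) n) (zeroExt U n)) N
  rw [Finset.sum_range_succ] at h3
  have h4 : 0 ≤ d.stageCost Q R (d.state x (zeroExt U) 0) (zeroExt U 0) :=
    (hR.inner_nonneg_left _).trans (d.le_stageCost hQ R _ _)
  rw [← state] at h2
  -- The input at step `N` is `0`, so prolonging the horizon by one step leaves the total unchanged;
  -- the shift merely loses the nonnegative first stage cost.
  rw [zeroExt_of_le U le_rfl] at h2 h3
  simp only [map_zero, inner_zero_left, mul_zero, add_zero] at h2
  linarith

theorem tendsto_zero_of_shift_sub_tendsto_zero {N : ℕ} {U : ℕ → Fin N → Vec m}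
    (h : Tendsto (fun k => shift (U k) - U (k + 1)) atTop (𝓝 0)) : Tendsto U atTop (𝓝 0) := by
  -- Induction from the end of the horizon: entry `n` of `U (k + 1)` is asymptotically entry `n + 1`
  -- of `U k`, and entries from `N` on vanish.
  have key (j : ℕ) : ∀ n, N ≤ n + j → Tendsto (fun k => zeroExt (U k) n) atTop (𝓝 0) := by
    induction j with
    | zero =>
      intro n hn
      simp only [zeroExt_of_le _ (show N ≤ n from hn)]
      exact tendsto_const_nhds
    | succ j ih =>
      intro n hn
      by_cases hnN : n < N
      · rw [← tendsto_add_atTop_iff_nat 1]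
        have h1 := (ih (n + 1) (by omega)).sub ((tendsto_pi_nhds.1 h) ⟨n, hnN⟩)
        simp only [Pi.zero_apply, sub_zero] at h1
        refine h1.congr fun k => ?_
        simp [shift, zeroExt, hnN]
      · simp only [zeroExt_of_le _ (not_lt.1 hnN)]
        exact tendsto_const_nhds
  refine tendsto_pi_nhds.2 fun i => ?_
  exact (key N i (by omega)).congr fun k => zeroExt_fin _ _

/-- A closed loop whose constraint sets are convex and recursively feasible by shifting the
optimal input sequence has optimal input sequences that converge to `0`. -/
theorem IsClosedLoop.tendsto_zero {d : DiscreteSystem X m p} {Q : Vec p →L[ℝ] Vec p}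
    (hQ : Q.IsPositive) {Qb : X →L[ℝ] X} (hL : d.IsLyapunovSolution Q Qb)
    {R : Vec m →L[ℝ] Vec m} (hR : R.IsPositive) (hR' : ∀ u, u ≠ 0 → 0 < inner ℝ (R u) u)
    {N : ℕ} {hN : 0 < N} {F : X → Set (Fin N → Vec m)}
    (hF : ∀ x, ∀ U ∈ F x, ∀ V ∈ F x, (1 / 2 : ℝ) • (U + V) ∈ F x) {x₀ : X} {x : ℕ → X}
    {U : ℕ → Fin N → Vec m} (hcl : d.IsClosedLoop Q R Qb hN F x₀ x U)
    (hshift : ∀ k, shift (U k) ∈ F (x (k + 1))) : Tendsto U atTop (𝓝 0) := by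
  obtain ⟨c, hc, hcR⟩ := exists_coercive_of_pos hR'
  set W : ℕ → ℝ := fun k => d.cost Q R Qb (x k) (U k) + inner ℝ (Qb (x k)) (x k) with hW
  have hW0 (k : ℕ) : 0 ≤ W k := by
    simp only [hW]
    rw [hL.cost_add hQ]
    exact add_nonneg (Finset.sum_nonneg fun n _ =>
      (hR.inner_nonneg_left _).trans (d.le_stageCost hQ R _ _)) (hL.1.inner_nonneg_left _)
  have hle (k : ℕ) : c * ‖shift (U k) - U (k + 1)‖ ^ 2 ≤ 2 * (W k - W (k + 1)) := by
    have h1 := norm_sq_sub_le_of_isMinOn hQ hL hc hcR (hF (x (k + 1))) (hshift k)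
      (hcl.feasible (k + 1)) (hcl.optimal (k + 1))
    have h2 := hL.cost_shift_le hQ hR hN (x k) (U k) (hcl.step k)
    simp only [hW]
    linarith
  have hanti : Antitone W := antitone_nat_of_succ_le fun k => by
    have h1 := hle k
    have h2 : 0 ≤ c * ‖shift (U k) - U (k + 1)‖ ^ 2 := by positivity
    linarith
  have hlim := tendsto_atTop_ciInf hanti ⟨0, by rintro _ ⟨k, rfl⟩; exact hW0 k⟩
  have hdiff : Tendsto (fun k => 2 * (W k - W (k + 1)) / c) atTop (𝓝 0) := by
    have h1 := ((hlim.sub ((tendsto_add_atTop_iff_nat 1).2 hlim)).const_mul 2).div_const c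
    simpa using h1
  refine tendsto_zero_of_shift_sub_tendsto_zero (tendsto_zero_iff_norm_tendsto_zero.2 ?_)
  have hsq : Tendsto (fun k => ‖shift (U k) - U (k + 1)‖ ^ 2) atTop (𝓝 0) :=
    squeeze_zero (fun k => by positivity) (fun k => (le_div_iff₀' hc).2 (hle k)) hdiff
  have := hsq.sqrt
  simpa using this

theorem exists_isMinOn_cost {d : DiscreteSystem X m p} {Q : Vec p →L[ℝ] Vec p}
    (hQ : Q.IsPositive) {Qb : X →L[ℝ] X} (hL : d.IsLyapunovSolution Q Qb)
    {R : Vec m →L[ℝ] Vec m} (hR' : ∀ u, u ≠ 0 → 0 < inner ℝ (R u) u) {N : ℕ} (x : X)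
    {F : Set (Fin N → Vec m)} (hF : IsClosed F) (hne : F.Nonempty) :
    ∃ U ∈ F, IsMinOn (d.cost Q R Qb x) F U := by
  obtain ⟨c, hc, hcR⟩ := exists_coercive_of_pos hR'
  obtain ⟨V, hV⟩ := hne
  exact (d.continuous_cost Q R Qb x).continuousOn.exists_isMinOn' hF hV
    (((tendsto_cost_cocompact hQ hL hc hcR x).eventually_ge_atTop _).filter_mono inf_le_left)

theorem isMinOn_cost_unique {d : DiscreteSystem X m p} {Q : Vec p →L[ℝ] Vec p}
    (hQ : Q.IsPositive) {Qb : X →L[ℝ] X} (hL : d.IsLyapunovSolution Q Qb)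
    {R : Vec m →L[ℝ] Vec m} (hR' : ∀ u, u ≠ 0 → 0 < inner ℝ (R u) u) {N : ℕ} {x : X}
    {F : Set (Fin N → Vec m)} (hF : ∀ U ∈ F, ∀ V ∈ F, (1 / 2 : ℝ) • (U + V) ∈ F)
    {U V : Fin N → Vec m} (hU : U ∈ F) (hUmin : IsMinOn (d.cost Q R Qb x) F U)
    (hV : V ∈ F) (hVmin : IsMinOn (d.cost Q R Qb x) F V) : U = V := by
  obtain ⟨c, hc, hcR⟩ := exists_coercive_of_pos hR'
  have h1 := norm_sq_sub_le_of_isMinOn hQ hL hc hcR hF hU hV hVmin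
  have h2 : d.cost Q R Qb x U ≤ d.cost Q R Qb x V := hUmin hV
  have h3 : c * ‖U - V‖ ^ 2 ≤ 0 := by linarith
  have h4 : ‖U - V‖ ^ 2 ≤ 0 := nonpos_of_mul_nonpos_right h3 hc
  exact sub_eq_zero.1 (norm_eq_zero.1 (pow_eq_zero_iff two_ne_zero |>.1
    (le_antisymm h4 (by positivity))))

theorem existsUnique_isClosedLoop {d : DiscreteSystem X m p} {Q : Vec p →L[ℝ] Vec p}
    (hQ : Q.IsPositive) {Qb : X →L[ℝ] X} (hL : d.IsLyapunovSolution Q Qb)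
    {R : Vec m →L[ℝ] Vec m} (hR' : ∀ u, u ≠ 0 → 0 < inner ℝ (R u) u)
    {N : ℕ} (hN : 0 < N) {F : X → Set (Fin N → Vec m)} (hFc : ∀ x, IsClosed (F x))
    (hF : ∀ x, ∀ U ∈ F x, ∀ V ∈ F x, (1 / 2 : ℝ) • (U + V) ∈ F x)
    (hshift : ∀ x, ∀ U ∈ F x, shift U ∈ F (d.Ad x + d.Bd (U ⟨0, hN⟩))) {x₀ : X}
    (hne : (F x₀).Nonempty) :
    ∃! z : (ℕ → X) × (ℕ → Fin N → Vec m), d.IsClosedLoop Q R Qb hN F x₀ z.1 z.2 := by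
  -- The feedback law is made total by the value `0` at infeasible states, which the loop never
  -- visits.
  have hμ (x : X) : ∃ U, (F x).Nonempty → U ∈ F x ∧ IsMinOn (d.cost Q R Qb x) (F x) U := by
    by_cases h : (F x).Nonempty
    · obtain ⟨U, hU, hmin⟩ := exists_isMinOn_cost hQ hL hR' x (hFc x) h
      exact ⟨U, fun _ => ⟨hU, hmin⟩⟩
    · exact ⟨0, fun h' => (h h').elim⟩
  choose μ hμ using hμ
  let ξ : ℕ → X := fun k => (fun x => d.Ad x + d.Bd (μ x ⟨0, hN⟩))^[k] x₀
  have hξ (k : ℕ) : ξ (k + 1) = d.Ad (ξ k) + d.Bd (μ (ξ k) ⟨0, hN⟩) :=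
    Function.iterate_succ_apply' _ _ _
  have hfeas (k : ℕ) : (F (ξ k)).Nonempty := by
    induction k with
    | zero => exact hne
    | succ k ih =>
      rw [hξ]
      exact ⟨_, hshift _ _ (hμ _ ih).1⟩
  refine ⟨(ξ, fun k => μ (ξ k)), ⟨rfl, fun k => (hμ _ (hfeas k)).1,
    fun k => (hμ _ (hfeas k)).2, hξ⟩, ?_⟩
  rintro ⟨x, U⟩ hz
  have hUx (k : ℕ) (hk : x k = ξ k) : U k = μ (ξ k) := by
    have h1 := hz.feasible k
    have h2 := hz.optimal k
    simp only [hk] at h1 h2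
    exact isMinOn_cost_unique hQ hL hR' (hF _) h1 h2 (hμ _ (hfeas k)).1 (hμ _ (hfeas k)).2
  have hx (k : ℕ) : x k = ξ k := by
    induction k with
    | zero => exact hz.initial
    | succ k ih =>
      have h1 := hz.step k
      simp only [hUx k ih, ih] at h1
      rw [hξ, h1]
  exact Prod.ext (funext hx) (funext fun k => hUx k (hx k))

end DiscreteSystem

end RegMPC

theorem theorem1 {X : Type*} [NormedAddCommGroup X] [InnerProductSpace ℝ X] [CompleteSpace X]
    {m p : ℕ} (S : RegMPC.RegularSystem X m p)
    (hstable : S.T.StronglyStable) (hadm : S.InfiniteTimeAdmissible)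
    (h : ℝ) (hh : 0 < h) (hδ : 2 / h ∈ RegMPC.resSet S.A)
    (Q : RegMPC.Vec p →L[ℝ] RegMPC.Vec p) (hQ : Q.IsPositive)
    (R : RegMPC.Vec m →L[ℝ] RegMPC.Vec m) (hR : R.IsPositive)
    (hR' : ∀ u, u ≠ 0 → 0 < inner ℝ (R u) u)
    (N : ℕ) (hN : 0 < N) (b : RegMPC.Bounds m p) :
    -- the Lyapunov equation has exactly one positive self-adjoint solution
    (∃! Qb : X →L[ℝ] X, (S.cayleyTustin (2 / h) hδ).IsLyapunovSolution Q Qb) ∧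
    ∀ Qb : X →L[ℝ] X, (S.cayleyTustin (2 / h) hδ).IsLyapunovSolution Q Qb →
      -- bounds imposed at all times along the continuation by zero inputs
      (∀ x₀ : X, ((S.cayleyTustin (2 / h) hδ).allTimeFeasible b N x₀).Nonempty →
        (∃! z : (ℕ → X) × (ℕ → Fin N → RegMPC.Vec m),
          (S.cayleyTustin (2 / h) hδ).IsClosedLoop Q R Qb hN
            ((S.cayleyTustin (2 / h) hδ).allTimeFeasible b N) x₀ z.1 z.2) ∧
        ∀ (x : ℕ → X) (U : ℕ → Fin N → RegMPC.Vec m),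
          (S.cayleyTustin (2 / h) hδ).IsClosedLoop Q R Qb hN
            ((S.cayleyTustin (2 / h) hδ).allTimeFeasible b N) x₀ x U →
          Filter.Tendsto U Filter.atTop (nhds 0) ∧
          Filter.Tendsto (fun k => U k ⟨0, hN⟩) Filter.atTop (nhds 0)) ∧
      -- bounds imposed over the horizon only, if the continuation by zero is admissible
      (∀ (x₀ : X) (x : ℕ → X) (U : ℕ → Fin N → RegMPC.Vec m),
        (S.cayleyTustin (2 / h) hδ).IsClosedLoop Q R Qb hN
          ((S.cayleyTustin (2 / h) hδ).horizonFeasible b N) x₀ x U →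
        (∀ k, (S.cayleyTustin (2 / h) hδ).BoundsHoldAt b (x k) (U k) N) →
        Filter.Tendsto U Filter.atTop (nhds 0) ∧
        Filter.Tendsto (fun k => U k ⟨0, hN⟩) Filter.atTop (nhds 0)) := by
  have hδ0 : 0 < 2 / h := by positivity
  refine ⟨S.existsUnique_isLyapunovSolution hstable hadm hδ0 hδ hQ, fun Qb hL =>
    ⟨fun x₀ hne => ⟨?_, fun x U hcl => ?_⟩, fun x₀ x U hcl hcont => ?_⟩⟩
  · exact RegMPC.DiscreteSystem.existsUnique_isClosedLoop hQ hL hR' hN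
      (fun x => RegMPC.DiscreteSystem.isClosed_allTimeFeasible _ b N x)
      (fun _ _ hU _ hV n => (hU n).midpoint (hV n))
      (fun _ _ hU => RegMPC.DiscreteSystem.shift_mem_allTimeFeasible hN hU) hne
  · have hlim := hcl.tendsto_zero hQ hL hR hR'
      (F := (S.cayleyTustin (2 / h) hδ).allTimeFeasible b N)
      (fun _ _ hV _ hW n => (hV n).midpoint (hW n)) fun k => by
        rw [hcl.step]
        exact RegMPC.DiscreteSystem.shift_mem_allTimeFeasible hN (hcl.feasible k)
    exact ⟨hlim, tendsto_pi_nhds.1 hlim ⟨0, hN⟩⟩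
  · have hmid : ∀ x, ∀ U ∈ (S.cayleyTustin (2 / h) hδ).horizonFeasible b N x,
        ∀ V ∈ (S.cayleyTustin (2 / h) hδ).horizonFeasible b N x,
        (1 / 2 : ℝ) • (U + V) ∈ (S.cayleyTustin (2 / h) hδ).horizonFeasible b N x := by
      intro x U hU V hV
      rw [RegMPC.DiscreteSystem.mem_horizonFeasible_iff] at hU hV ⊢
      exact fun n hn => (hU n hn).midpoint (hV n hn)
    have hlim := hcl.tendsto_zero hQ hL hR hR' hmid fun k => by
      rw [hcl.step]
      exact RegMPC.DiscreteSystem.shift_mem_horizonFeasible hN (hcl.feasible k) (hcont k)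
    exact ⟨hlim, tendsto_pi_nhds.1 hlim ⟨0, hN⟩⟩
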